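/- \textbf{Notation.} For $r\ge 2$ and $[n]=\{1,\dots,n\}$, let $\nu(F)$ be the matching number of a hypergraph $F$ and $m_r(n,s)=\max\{|F|:F\subseteq\binom{[n]}r,\ \nu(F)\le s\}$. Put $a_r(s)=\binom{rs+r-1}{r}$, $b_r(n,s)=\binom nr-\binom{n-s}r$ and $n_r(s)=\min\{n\ge r(s+1): a_r(s)\le b_r(n,s)\}$. For $r$-sets $A=\{a_1<\dots<a_r\}$, $B=\{b_1<\dots<b_r\}$ write $A\preceq B$ if $a_i\le b_i$ for all $i$. An $r$-graph $F\subseteq\binom{[n]}r$ is \emph{stable} if $B\in F$ and $A\preceq B$ imply $A\in F$; it has \emph{property ONE} if some maximum matching of $F$ avoids vertex $1$; it is \emph{maximal} if $\nu(F\cup\{Q\})=\nu(F)+1$ for every $r$-set $Q\in\binom{[n]}r\setminus F$. A \emph{selection rule} $\mathfrak S$ assigns to every stable maximal property-ONE $F\subseteq\binom{[n]}r$ with $\nu(F)=s$ and $n\ge rs+r-1$ a matching $E_1,\dots,E_s\in F$ avoiding vertex $1$ and contained in $K=[rs+r-1]$. Let $B_r=R\sqcup C_1\sqcup\dots\sqcup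 C_r$ with $|R|=r-1$ and $|C_i|=r$, and for $X\subseteq B_r$ let $z(X)$ be the number of $i$ with $X\cap C_i\ne\varnothing$. A set $L\subseteq\bigcup_{j=2}^r\binom{B_r}j$ is an \emph{actual selected local configuration} for $(r,s,q)$ and $\mathfrak S$ if there are a stable maximal property-ONE $F\subseteq\binom{[n]}r$ with $\nu(F)=s$ and $n=rs+r-1+q$, with matching $E_1,\dots,E_s$ selected by $\mathfrak S$, a set $\tau\in\binom{[s]}r$, and, with $R_F=K\setminus\bigcup_{i\le s}E_i$ and $V_\tau=R_F\cup\bigcup_{i\in\tau}E_i$, a bijection $V_\tau\to B_r$ that maps $R_F$ to $R$ and the edges $E_i$ $(i\in\tau)$ to $C_1,\dots,C_r$ in some order, such that $L$ is the image of $\{E\cap K: E\in F,\ E\cap K\subseteq V_\tau\}$. Put $$\Phi_{s,q}(L)=\sum_{H\in L,\ 2\le|H|<r}\frac{\binom q{r-|H|}}{\binom{s-z(H)}{r-z(H)}}-\sum_{T\in\binom{B_r}r\setminus L}\frac1{\binom{s-z(T)}{r-z(T)}}.$$ \textbf{Theorem.} Fix $r\ge2$. There is an integer $s_{\rm gap}\ge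 1$ such that $$n_r(t)-n_r(t-1)\ge2\quad\text{and}\quad n_r(t)-1\ge r(t+1)\qquad\text{for all }t\ge s_{\rm gap}.\tag{$*$}$$ Moreover, let $s_{\rm gap}\ge 1$ be any integer satisfying $(*)$, let $\mathfrak S$ be a selection rule, and let $s_{\rm link},s_{\rm board}\ge 0$ be integers such that: (i) for all $t\ge s_{\rm link}$ and all $m\ge n_r(t)$, every $J\subseteq\binom{[m]}{r-1}$ with $\nu(J)\le t$ satisfies $|J|\le\binom m{r-1}-\binom{m-t}{r-1}$; (ii) for all $t\ge s_{\rm board}$ and all $n\in\{n_r(t)-1,n_r(t)\}$, with $q=n-(rt+r-1)$, every actual selected local configuration $L$ for $(r,t,q)$ and $\mathfrak S$ satisfies $\Phi_{t,q}(L)\le0$. Put $S_r=\max\{r,s_{\rm gap},s_{\rm link},s_{\rm board}\}$. Then for all $s\ge 2S_r-1$ and all $n\ge r(s+1)$, $$m_r(n,s)=\max\left\{\binom{rs+r-1}r,\ \binom nr-\binom{n-s}r\right\}.$$ -/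

import Mathlib

namespace EMC

/-- All `r`-element subsets of the vertex set `[n] = {1, …, n}`. -/
def allEdges (r n : ℕ) : Finset (Finset ℕ) :=
  (Finset.Icc 1 n).powersetCard r

/-- `M` is a matching of the hypergraph `F`: a set of pairwise disjoint edges of `F`. -/
def IsMatching (F M : Finset (Finset ℕ)) : Prop :=
  M ⊆ F ∧ ∀ A ∈ M, ∀ B ∈ M, A ≠ B → Disjoint A B

open Classical in
/-- The matching number `ν(F)`: the largest number of edges in a matching of `F`. -/
noncomputable def matchingNumber (F : Finset (Finset ℕ)) : ℕ :=
  (F.powerset.filter (fun M => IsMatching F M)).sup Finset.card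

open Classical in
/-- `m_r(n, s)`: the largest number of edges of an `r`-graph on `[n]` with matching number at
most `s`. -/
noncomputable def maxEdges (r n s : ℕ) : ℕ :=
  ((allEdges r n).powerset.filter (fun F => matchingNumber F ≤ s)).sup Finset.card

/-- The clique term `a_r(s)`. -/
def cliqueTerm (r s : ℕ) : ℕ := (r * s + r - 1).choose r

/-- The cover term `b_r(n, s)`; the subtractions are exact for `s ≤ n`. -/
def coverTerm (r n s : ℕ) : ℕ := n.choose r - (n - s).choose r

/-- `M_r(n, s)`. -/
def extremalBound (r n s : ℕ) : ℕ := max (cliqueTerm r s) (coverTerm r n s)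

/-- The transition value `n_r(s)`, the least `n ≥ r (s + 1)` with `a_r(s) ≤ b_r(n, s)`.
(For `r ≥ 2` such `n` exist, since the cover term is then unbounded in `n` unless `s = 0`, where
the inequality reads `0 ≤ 0`.) -/
noncomputable def transition (r s : ℕ) : ℕ :=
  sInf {n : ℕ | r * (s + 1) ≤ n ∧ cliqueTerm r s ≤ coverTerm r n s}

/-- `A ⪯ B` for `r`-sets: writing both sets increasingly, `a_i ≤ b_i` for every `i`. -/
def CoordLE (r : ℕ) (A B : Finset ℕ) : Prop :=
  ∃ (hA : A.card = r) (hB : B.card = r),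
    ∀ i : Fin r, A.orderEmbOfFin hA i ≤ B.orderEmbOfFin hB i

/-- `F` is a stable `r`-graph on `[n]`. -/
def IsStable (r n : ℕ) (F : Finset (Finset ℕ)) : Prop :=
  F ⊆ allEdges r n ∧
    ∀ B ∈ F, ∀ A ∈ allEdges r n, CoordLE r A B → A ∈ F

/-- Property ONE: some maximum matching avoids vertex `1`. -/
def HasOne (F : Finset (Finset ℕ)) : Prop :=
  ∃ M, IsMatching F M ∧ M.card = matchingNumber F ∧ ∀ E ∈ M, 1 ∉ E

/-- Maximality of `F` with respect to `ν ≤ ν(F)`: adding any missing `r`-set of `[n]` raises the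
matching number by one. -/
def IsMaximal (r n : ℕ) (F : Finset (Finset ℕ)) : Prop :=
  ∀ Q ∈ allEdges r n, Q ∉ F → matchingNumber (insert Q F) = matchingNumber F + 1

/-- The families to which the reduction is applied: stable maximal property-ONE `r`-graphs on `[n]`
with matching number `s`. -/
def IsStableMaximalOne (r n s : ℕ) (F : Finset (Finset ℕ)) : Prop :=
  IsStable r n F ∧ matchingNumber F = s ∧ HasOne F ∧ IsMaximal r n F

/-- The initial segment `K = [rs + r - 1]`. -/
def core (r s : ℕ) : Finset ℕ := Finset.Icc 1 (r * s + r - 1)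

/-- A selected compressed matching: an `s`-matching of `F` avoiding vertex `1` and contained in
`K`. -/
def IsCompressedMatching (r s : ℕ) (F M : Finset (Finset ℕ)) : Prop :=
  IsMatching F M ∧ M.card = s ∧ ∀ E ∈ M, 1 ∉ E ∧ E ⊆ core r s

/-- A selection rule: it assigns a selected compressed matching to every stable maximal
property-ONE `r`-graph on `[n]`, where `n ≥ rs + r - 1` and `s` is the matching number. The values
on other families are irrelevant. -/
structure SelectionRule (r : ℕ) where
  /-- The matching selected for the `r`-graph `F` on `[n]`. -/
  select : (n : ℕ) → (F : Finset (Finset ℕ)) → Finset (Finset ℕ)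
  isCompressed : ∀ (n s : ℕ) (F : Finset (Finset ℕ)), r * s + r - 1 ≤ n →
    IsStableMaximalOne r n s F → IsCompressedMatching r s F (select n F)

/-- The trace family `{E ∩ K : E ∈ F}`. -/
def traces (r s : ℕ) (F : Finset (Finset ℕ)) : Finset (Finset ℕ) :=
  F.image (fun E => E ∩ core r s)

/-- The residual set `R_F`, the vertices of `K` not covered by the matching `M`. -/
def residual (r s : ℕ) (M : Finset (Finset ℕ)) : Finset ℕ :=
  core r s \ M.biUnion id

/-- The local board `V_τ = R_F ∪ ⋃_{E ∈ τ} E`, for a set `τ` of edges of the matching `M`. -/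
def localBoard (r s : ℕ) (M τ : Finset (Finset ℕ)) : Finset ℕ :=
  residual r s M ∪ τ.biUnion id

/-- The local traces: the traces contained in the local board `V_τ`. -/
def localTraces (r s : ℕ) (F M τ : Finset (Finset ℕ)) : Finset (Finset ℕ) :=
  (traces r s F).filter (fun H => H ⊆ localBoard r s M τ)

/-- The abstract board `B_r = R ⊔ C_1 ⊔ ⋯ ⊔ C_r` with `|R| = r - 1` and `|C_i| = r`. -/
abbrev Board (r : ℕ) : Type := Fin (r - 1) ⊕ (Fin r × Fin r)

/-- The residual part `R` of the board. -/
def boardResidual (r : ℕ) : Finset (Board r) :=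
  Finset.univ.image (fun j : Fin (r - 1) => Sum.inl j)

/-- The column `C_i` of the board. -/
def boardColumn (r : ℕ) (i : Fin r) : Finset (Board r) :=
  Finset.univ.image (fun j : Fin r => Sum.inr (i, j))

/-- The spread `z(X)`: the number of columns met by `X`. -/
def spread {r : ℕ} (X : Finset (Board r)) : ℕ :=
  (Finset.univ.filter (fun i : Fin r => (X ∩ boardColumn r i).Nonempty)).card

/-- `L` is an actual selected local configuration for `(r, s, q)` with respect to the selection
rule `S`. -/
def IsActual {r : ℕ} (S : SelectionRule r) (s q : ℕ) (L : Finset (Finset (Board r))) : Prop :=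
  (∀ X ∈ L, 2 ≤ X.card ∧ X.card ≤ r) ∧
  ∃ F : Finset (Finset ℕ), IsStableMaximalOne r (r * s + r - 1 + q) s F ∧
  ∃ τ : Finset (Finset ℕ), τ ⊆ S.select (r * s + r - 1 + q) F ∧ τ.card = r ∧
  ∃ φ : ℕ → Board r,
    Set.BijOn φ (localBoard r s (S.select (r * s + r - 1 + q) F) τ) Set.univ ∧
    (residual r s (S.select (r * s + r - 1 + q) F)).image φ = boardResidual r ∧
    (∃ σ : τ ≃ Fin r, ∀ E : τ, (E : Finset ℕ).image φ = boardColumn r (σ E)) ∧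
    L = (localTraces r s F (S.select (r * s + r - 1 + q) F) τ).image (fun H => H.image φ)

/-- The local functional `Φ_{s,q}(L)`. -/
def localFunctional {r : ℕ} (s q : ℕ) (L : Finset (Finset (Board r))) : ℚ :=
  (∑ H ∈ L.filter (fun H => 2 ≤ H.card ∧ H.card < r),
      (q.choose (r - H.card) : ℚ) / ((s - spread H).choose (r - spread H) : ℚ)) -
  ∑ T ∈ ((Finset.univ : Finset (Board r)).powersetCard r).filter (fun T => T ∉ L),
      (1 : ℚ) / ((s - spread T).choose (r - spread T) : ℚ)

/-- The link-bound input with threshold `sLink`: the cover-side bound for `(r-1)`-uniform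
hypergraphs on `m` vertices with matching number at most `t`. -/
def LinkBoundInput (r sLink : ℕ) : Prop :=
  ∀ t, sLink ≤ t → ∀ m, transition r t ≤ m →
    ∀ J ⊆ allEdges (r - 1) m, matchingNumber J ≤ t →
      J.card ≤ coverTerm (r - 1) m t

/-- The finite-board input for the selection rule `S` with threshold `sBoard`. -/
def FiniteBoardInput {r : ℕ} (S : SelectionRule r) (sBoard : ℕ) : Prop :=
  ∀ t, sBoard ≤ t → ∀ n, (n = transition r t - 1 ∨ n = transition r t) →
    ∀ L, IsActual S t (n - (r * t + r - 1)) L →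
      localFunctional t (n - (r * t + r - 1)) L ≤ 0

/-- Admissibility of `sGap`: `n_r(t) - n_r(t-1) ≥ 2` and `n_r(t) - 1 ≥ r (t + 1)` for all
`t ≥ sGap`. (The second condition fails at `t = 0`, where `n_r(0) = r`, so that `t - 1` is never
truncated.) -/
def IsGapThreshold (r sGap : ℕ) : Prop :=
  ∀ t, sGap ≤ t → transition r (t - 1) + 2 ≤ transition r t ∧ r * (t + 1) + 1 ≤ transition r t

end EMC

/-!
The upper bound rests on three ingredients.

*Stability.* Among the largest families with matching number at most `s`, one of least total vertex
weight is closed under downward shifts (`exists_stable_maximal`), because a shift keeps the size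
and does not raise the matching number. So only stable maximal families matter.

*Property ONE at the transition.* For a stable maximal property-ONE family `F` on `[n]`, count the
edges by their traces on the core `K`. Every trace has at least two vertices, and a trace meeting `z`
edges of the selected matching lies in exactly `(s - z).choose (r - z)` local boards. Summing the
local functional over all boards therefore gives exactly the number of ways to extend the traces of
size less than `r` to `r`-sets, minus the number of `r`-subsets of `K` missing from `F`. If every
local value is nonpositive, then `F` is no larger than the clique on `K` (`card_le_cliqueTerm`).
Above the transition value `N`, restrict to `[N]` and enlarge to a maximal family. Property ONE
survives, as a maximum matching avoiding vertex `1` can be compressed into `[2, rs + 1]`; the link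
bound then carries the estimate from `[N]` to `[n]` (`card_le_coverTerm_of_restrict`).

*Without property ONE.* Deleting vertex `1` reduces `(n, s)` to `(n - 1, s - 1)`, where the cover term
drops by exactly `(n - 1).choose (r - 1)`. The gap condition keeps `n - i` at or above the transition
value for `s - i`. The descent stops at `t₀ = ⌊s / 2⌋`: there the number of vertices is still at least
`r (s + 1) - (s - t₀) ≥ (2 t₀ + 1) r - t₀`, a range in which the cover bound holds unconditionally
(`IsStable.card_le_coverTerm`). That bound compares the edges meeting `[t₀ + 1]` in at most one vertex
with the corresponding edges of the cover construction. The edges missing `[t₀ + 1]` are estimated by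
their shadow, as a shifted family has at most `t₀` times as many members as its shadow
(`card_le_mul_card_shadow`); the links of single vertices form nested cross-dependent families, whose
sizes are bounded by averaging over random disjoint `l`-sets (`sum_card_le_of_crossDependent`).

Below the transition value the bound follows by monotonicity in `n`.

The gap condition for large `t` is explicit for `r = 2`. For `r ≥ 3` the transition value is at most
`(r + 1) t`, and the increments of the two terms are compared through their leading coefficients
(`exists_isGapThreshold`).
-/

namespace EMC

open Finset

open scoped FinsetFamily

/-! ### Matchings and the matching number -/

lemma mem_allEdges {r n : ℕ} {E : Finset ℕ} : E ∈ allEdges r n ↔ E ⊆ Icc 1 n ∧ E.card = r :=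
  mem_powersetCard

lemma card_allEdges (r n : ℕ) : (allEdges r n).card = n.choose r := by
  simp [allEdges]

lemma matchingNumber_le_iff {F : Finset (Finset ℕ)} {s : ℕ} :
    matchingNumber F ≤ s ↔ ∀ M, IsMatching F M → M.card ≤ s := by
  classical
  simp only [matchingNumber, Finset.sup_le_iff, mem_filter, mem_powerset]
  exact ⟨fun h M hM => h M ⟨hM.1, hM⟩, fun h M hM => h M hM.2⟩

lemma IsMatching.card_le {F M : Finset (Finset ℕ)} (h : IsMatching F M) :
    M.card ≤ matchingNumber F :=
  matchingNumber_le_iff.1 le_rfl M h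

lemma IsMatching.mono {F G M : Finset (Finset ℕ)} (h : IsMatching F M) (hFG : F ⊆ G) :
    IsMatching G M :=
  ⟨h.1.trans hFG, h.2⟩

lemma IsMatching.subset {F M N : Finset (Finset ℕ)} (h : IsMatching F M) (hN : N ⊆ M) :
    IsMatching F N :=
  ⟨hN.trans h.1, fun A hA B hB => h.2 A (hN hA) B (hN hB)⟩

lemma matchingNumber_mono {F G : Finset (Finset ℕ)} (h : F ⊆ G) :
    matchingNumber F ≤ matchingNumber G :=
  matchingNumber_le_iff.2 fun _ hM => (hM.mono h).card_le

lemma matchingNumber_insert_le (F : Finset (Finset ℕ)) (Q : Finset ℕ) :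
    matchingNumber (insert Q F) ≤ matchingNumber F + 1 := by
  refine matchingNumber_le_iff.2 fun M hM => ?_
  have h : IsMatching F (M.erase Q) := by
    refine ⟨fun E hE => ?_, fun A hA B hB => hM.2 A (mem_of_mem_erase hA) B (mem_of_mem_erase hB)⟩
    exact (mem_insert.1 (hM.1 (mem_of_mem_erase hE))).resolve_left (ne_of_mem_erase hE)
  have := h.card_le
  have := pred_card_le_card_erase (s := M) (a := Q)
  omega

lemma card_le_maxEdges {r n s : ℕ} {F : Finset (Finset ℕ)} (hF : F ⊆ allEdges r n)
    (h : matchingNumber F ≤ s) : F.card ≤ maxEdges r n s := by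
  classical
  unfold maxEdges
  exact le_sup (f := Finset.card) (mem_filter.2 ⟨mem_powerset.2 hF, h⟩)

lemma maxEdges_le_iff {r n s b : ℕ} :
    maxEdges r n s ≤ b ↔ ∀ F ⊆ allEdges r n, matchingNumber F ≤ s → F.card ≤ b := by
  classical
  simp only [maxEdges, Finset.sup_le_iff, mem_filter, mem_powerset]
  exact ⟨fun h F h1 h2 => h F ⟨h1, h2⟩, fun h F hF => h F hF.1 hF.2⟩

lemma allEdges_mono {r m n : ℕ} (h : m ≤ n) : allEdges r m ⊆ allEdges r n :=
  powersetCard_mono (Icc_subset_Icc_right h)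

lemma maxEdges_mono {r m n s : ℕ} (h : m ≤ n) : maxEdges r m s ≤ maxEdges r n s :=
  maxEdges_le_iff.2 fun _ hF hs => card_le_maxEdges (hF.trans (allEdges_mono h)) hs

lemma card_biUnion_of_isMatching {r : ℕ} {F M : Finset (Finset ℕ)} (hM : IsMatching F M)
    (hr : ∀ E ∈ M, E.card = r) : (M.biUnion id).card = M.card * r := by
  rw [card_biUnion (t := id) (fun A hA B hB hAB => hM.2 A hA B hB hAB)]
  exact sum_const_nat hr

/-- Pairwise disjoint nonempty edges, indexed by a finite set, form a matching of the size of the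
index set. -/
lemma isMatching_image {ι : Type*} {F : Finset (Finset ℕ)} {M : Finset ι}
    (f : ι → Finset ℕ) (hF : ∀ i ∈ M, f i ∈ F) (hne : ∀ i ∈ M, (f i).Nonempty)
    (hd : ∀ i ∈ M, ∀ j ∈ M, i ≠ j → Disjoint (f i) (f j)) :
    IsMatching F (M.image f) ∧ (M.image f).card = M.card := by
  refine ⟨⟨fun E hE => ?_, fun A hA B hB hAB => ?_⟩, card_image_of_injOn ?_⟩
  · obtain ⟨D, hD, rfl⟩ := mem_image.1 hE
    exact hF D hD
  · obtain ⟨A, hA', rfl⟩ := mem_image.1 hA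
    obtain ⟨B, hB', rfl⟩ := mem_image.1 hB
    exact hd A hA' B hB' fun h => hAB (by rw [h])
  · intro A hA B hB hAB
    by_contra hne'
    have h := hd A hA B hB hne'
    have hAB' : f A = f B := hAB
    rw [hAB', disjoint_self_iff_empty] at h
    exact (hne B hB).ne_empty h

/-! ### The coordinatewise order and shifted families -/

lemma orderEmbOfFin_le_iff {r : ℕ} {A : Finset ℕ} (hA : A.card = r) (i : Fin r) (k : ℕ) :
    A.orderEmbOfFin hA i ≤ k ↔ (i : ℕ) < (A.filter (· ≤ k)).card := by
  have himg : (A.filter (· ≤ k)).card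
      = (univ.filter fun j : Fin r => A.orderEmbOfFin hA j ≤ k).card := by
    rw [← card_map (A.orderEmbOfFin hA).toEmbedding]
    congr 1
    ext x
    simp only [mem_filter, mem_map, mem_univ, true_and]
    constructor
    · rintro ⟨hx, hk⟩
      rw [← image_orderEmbOfFin_univ A hA] at hx
      obtain ⟨j, -, rfl⟩ := mem_image.1 hx
      exact ⟨j, hk, rfl⟩
    · rintro ⟨j, hj, rfl⟩
      exact ⟨orderEmbOfFin_mem _ _ _, hj⟩
  rw [himg]
  constructor
  · intro h
    have hsub : Finset.Iic i ⊆ univ.filter fun j : Fin r => A.orderEmbOfFin hA j ≤ k := by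
      intro j hj
      simp only [mem_filter, mem_univ, true_and]
      exact ((A.orderEmbOfFin hA).monotone (mem_Iic.1 hj)).trans h
    have := card_le_card hsub
    rw [Fin.card_Iic] at this
    omega
  · intro h
    by_contra hcon
    have hsub : (univ.filter fun j : Fin r => A.orderEmbOfFin hA j ≤ k) ⊆ Finset.Iio i := by
      intro j hj
      simp only [mem_filter, mem_univ, true_and] at hj
      rw [mem_Iio]
      by_contra hij
      exact hcon (((A.orderEmbOfFin hA).monotone (not_lt.1 hij)).trans hj)
    have := card_le_card hsub
    rw [Fin.card_Iio] at this
    omega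

/-- The coordinatewise order in terms of initial segments: `A ⪯ B` if and only if every initial
segment contains at least as many elements of `A` as of `B`. -/
lemma coordLE_iff {r : ℕ} {A B : Finset ℕ} :
    CoordLE r A B ↔ A.card = r ∧ B.card = r ∧
      ∀ k, (B.filter (· ≤ k)).card ≤ (A.filter (· ≤ k)).card := by
  constructor
  · rintro ⟨hA, hB, h⟩
    refine ⟨hA, hB, fun k => ?_⟩
    by_contra hcon
    push Not at hcon
    have hlt : (A.filter (· ≤ k)).card < r :=
      hcon.trans_le ((card_filter_le _ _).trans hB.le)
    have h1 := (orderEmbOfFin_le_iff hB ⟨_, hlt⟩ k).2 hcon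
    have h2 := (orderEmbOfFin_le_iff hA ⟨_, hlt⟩ k).1 ((h _).trans h1)
    simp at h2
  · rintro ⟨hA, hB, h⟩
    refine ⟨hA, hB, fun i => ?_⟩
    rw [orderEmbOfFin_le_iff]
    exact ((orderEmbOfFin_le_iff hB i _).1 le_rfl).trans_le (h _)

lemma coordLE_image {r : ℕ} {B : Finset ℕ} (hB : B.card = r) (f : ℕ → ℕ)
    (hinj : Set.InjOn f B) (hf : ∀ x ∈ B, f x ≤ x) : CoordLE r (B.image f) B := by
  refine coordLE_iff.2 ⟨by rw [card_image_of_injOn hinj, hB], hB, fun k => ?_⟩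
  rw [← card_image_of_injOn (s := B.filter (· ≤ k)) (f := f)
    (hinj.mono (coe_subset.2 (filter_subset _ _)))]
  refine card_le_card fun y hy => ?_
  obtain ⟨x, hx, rfl⟩ := mem_image.1 hy
  rw [mem_filter] at hx ⊢
  exact ⟨mem_image_of_mem _ hx.1, (hf x hx.1).trans hx.2⟩

/-- In a stable family the vertices of an edge may be moved injectively downwards. -/
lemma IsStable.image_mem {r n : ℕ} {F : Finset (Finset ℕ)} (hF : IsStable r n F)
    {B : Finset ℕ} (hB : B ∈ F) (f : ℕ → ℕ) (hinj : Set.InjOn f B)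
    (hf : ∀ x ∈ B, 1 ≤ f x ∧ f x ≤ x) : B.image f ∈ F := by
  have hBe := mem_allEdges.1 (hF.1 hB)
  refine hF.2 B hB _ (mem_allEdges.2 ⟨fun y hy => ?_, ?_⟩)
    (coordLE_image hBe.2 f hinj fun x hx => (hf x hx).2)
  · obtain ⟨x, hx, rfl⟩ := mem_image.1 hy
    have := mem_Icc.1 (hBe.1 hx)
    exact mem_Icc.2 ⟨(hf x hx).1, (hf x hx).2.trans this.2⟩
  · rw [card_image_of_injOn hinj, hBe.2]

/-- `F` is closed under replacing a vertex of an edge by a smaller vertex `≥ lo` off the edge. -/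
def ShiftClosed (lo : ℕ) (F : Finset (Finset ℕ)) : Prop :=
  ∀ E ∈ F, ∀ j ∈ E, ∀ i, lo ≤ i → i < j → i ∉ E → insert i (E.erase j) ∈ F

lemma IsStable.shiftClosed {r n : ℕ} {F : Finset (Finset ℕ)} (hF : IsStable r n F) :
    ShiftClosed 1 F := by
  intro E hE j hj i hi hij hiE
  have h : E.image (fun x => if x = j then i else x) = insert i (E.erase j) := by
    ext x
    simp only [mem_image, mem_insert, mem_erase]
    constructor
    · rintro ⟨y, hy, rfl⟩
      by_cases hyj : y = j <;> simp [hyj, hy]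
    · rintro (rfl | ⟨h1, h2⟩)
      · exact ⟨j, hj, by simp⟩
      · exact ⟨x, h2, by simp [h1]⟩
  rw [← h]
  refine hF.image_mem hE _ ?_ ?_
  · intro x hx y hy hxy
    have hx' : x ≠ i := fun h => hiE (h ▸ hx)
    have hy' : y ≠ i := fun h => hiE (h ▸ hy)
    simp only at hxy
    split_ifs at hxy <;> omega
  · intro x hx
    have := mem_Icc.1 ((mem_allEdges.1 (hF.1 hE)).1 hx)
    split_ifs <;> omega

/-- A family closed under single downward shifts is stable: a set `A ⪯ B` is reached from `B` by
repeatedly replacing the least element of `B \ A` by the least element of `A \ B`. -/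
lemma ShiftClosed.isStable {r n : ℕ} {F : Finset (Finset ℕ)} (hF : F ⊆ allEdges r n)
    (h : ShiftClosed 1 F) : IsStable r n F := by
  refine ⟨hF, fun B hB A hA hAB => ?_⟩
  obtain ⟨hAr, hBr, hcount⟩ := coordLE_iff.1 hAB
  clear hAB
  induction hk : (B \ A).card using Nat.strong_induction_on generalizing B with
  | _ k ih =>
    by_cases hBA : B \ A = ∅
    · have hsub : B ⊆ A := sdiff_eq_empty_iff_subset.1 hBA
      rwa [← eq_of_subset_of_card_le hsub (by omega)]
    · have hBne : (B \ A).Nonempty := nonempty_iff_ne_empty.2 hBA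
      have hAne : (A \ B).Nonempty := by
        rw [← card_pos, card_sdiff_comm (by omega : A.card = B.card)]
        exact card_pos.2 hBne
      set x := (A \ B).min' hAne with hx
      set y := (B \ A).min' hBne with hy
      have hxm := mem_sdiff.1 ((A \ B).min'_mem hAne)
      have hym := mem_sdiff.1 ((B \ A).min'_mem hBne)
      rw [← hx] at hxm
      rw [← hy] at hym
      have hxlt : ∀ z ∈ A, z < x → z ∈ B := fun z hz hzx => by
        by_contra hzB
        exact absurd (min'_le _ z (mem_sdiff.2 ⟨hz, hzB⟩)) (by omega)
      have hylt : ∀ z ∈ B, z < y → z ∈ A := fun z hz hzy => by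
        by_contra hzB
        exact absurd (min'_le _ z (mem_sdiff.2 ⟨hz, hzB⟩)) (by omega)
      have hxy : x < y := by
        by_contra hcon
        have hne : x ≠ y := fun h => hym.2 (h ▸ hxm.1)
        have hss : A.filter (· ≤ y) ⊂ B.filter (· ≤ y) := by
          refine (ssubset_iff_of_subset fun z hz => ?_).2 ⟨y, by simp [hym.1], by simp [hym.2]⟩
          rw [mem_filter] at hz ⊢
          exact ⟨hxlt z hz.1 (by omega), hz.2⟩
        exact absurd (hcount y) (not_le.2 (card_lt_card hss))
      have hx1 : 1 ≤ x := (mem_Icc.1 ((mem_allEdges.1 hA).1 hxm.1)).1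
      have hcard : (insert x (B.erase y)).card = B.card := by
        rw [card_insert_of_notMem (fun h => hxm.2 (mem_of_mem_erase h)),
          card_erase_add_one hym.1]
      refine ih _ ?_ (insert x (B.erase y)) (h B hB y hym.1 x hx1 hxy hxm.2)
        (hcard.trans hBr) (fun m => ?_) rfl
      · rw [← hk]
        refine card_lt_card ((ssubset_iff_of_subset fun z hz => ?_).2
          ⟨y, mem_sdiff.2 hym, fun hc => ?_⟩)
        · rw [mem_sdiff, mem_insert, mem_erase] at hz
          rcases hz with ⟨rfl | hz, hzA⟩
          · exact absurd hxm.1 hzA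
          · exact mem_sdiff.2 ⟨hz.2, hzA⟩
        · rw [mem_sdiff, mem_insert, mem_erase] at hc
          rcases hc.1 with hc | hc
          · omega
          · exact hc.1 rfl
      · by_cases hmy : y ≤ m
        · refine le_trans (le_of_eq ?_) (hcount m)
          rw [filter_insert, filter_erase, if_pos (by omega : x ≤ m),
            card_insert_of_notMem (by simp [hxm.2]), card_erase_add_one (by simp [hym.1, hmy])]
        · refine card_le_card fun z hz => ?_
          rw [mem_filter, mem_insert, mem_erase] at hz
          rw [mem_filter]
          refine ⟨?_, hz.2⟩
          rcases hz.1 with rfl | h2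
          · exact hxm.1
          · exact hylt z h2.2 (by omega)

/-! ### Downward shifts and extremal families -/

lemma compress_singleton {i j : ℕ} (hij : i ≠ j) (E : Finset ℕ) :
    UV.compress {i} {j} E = if j ∈ E ∧ i ∉ E then insert i (E.erase j) else E := by
  unfold UV.compress
  simp only [disjoint_singleton_left, singleton_subset_iff]
  by_cases h : j ∈ E ∧ i ∉ E
  · rw [if_pos h, if_pos h.symm]
    ext x
    simp only [sup_eq_union, mem_sdiff, mem_union, mem_singleton, mem_insert, mem_erase]
    constructor
    · tauto
    · rintro (rfl | h) <;> tauto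
  · rw [if_neg h, if_neg (fun h' => h h'.symm)]

/-- If `M` is a matching of the shifted family that is not contained in `F`, then interchanging
`i` and `j` in all edges of `M` turns it into a matching of `F`. -/
lemma matchingNumber_compression_le {i j : ℕ} (hij : i ≠ j) (F : Finset (Finset ℕ)) :
    matchingNumber (𝓒 {i} {j} F) ≤ matchingNumber F := by
  refine matchingNumber_le_iff.2 fun M hM => ?_
  by_cases hMF : M ⊆ F
  · exact IsMatching.card_le ⟨hMF, hM.2⟩
  obtain ⟨A, hAM, hAF⟩ := not_subset.1 hMF
  have key : ∀ D, D ∈ 𝓒 {i} {j} F → D ∉ F →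
      i ∈ D ∧ D.image (Equiv.swap i j) ∈ F := by
    intro D hD hDF
    rw [UV.mem_compression] at hD
    rcases hD with hD | ⟨-, B, hB, rfl⟩
    · exact absurd hD.1 hDF
    rw [compress_singleton hij] at hDF ⊢
    split_ifs at hDF ⊢ with h
    · refine ⟨mem_insert_self _ _, ?_⟩
      convert hB using 1
      ext x
      simp only [mem_image, mem_insert, mem_erase]
      constructor
      · rintro ⟨y, rfl | ⟨hyj, hy⟩, rfl⟩
        · simpa using h.1
        · rwa [Equiv.swap_apply_of_ne_of_ne (fun hyi : y = i => h.2 (hyi ▸ hy)) hyj]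
      · intro hx
        by_cases hxj : x = j
        · exact ⟨i, Or.inl rfl, by simp [hxj]⟩
        · exact ⟨x, Or.inr ⟨hxj, hx⟩,
            Equiv.swap_apply_of_ne_of_ne (fun hxi : x = i => h.2 (hxi ▸ hx)) hxj⟩
    · exact absurd hB hDF
  obtain ⟨hiA, hA'⟩ := key A (hM.1 hAM) hAF
  have hinj : Function.Injective fun D : Finset ℕ => D.image (Equiv.swap i j) :=
    image_injective (Equiv.injective _)
  rw [← card_image_of_injective M hinj]
  refine IsMatching.card_le ⟨fun D hD => ?_, fun D hD D' hD' hne => ?_⟩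
  · obtain ⟨D, hDM, rfl⟩ := mem_image.1 hD
    by_cases hDA : D = A
    · rwa [hDA]
    have hiD : i ∉ D := fun h => disjoint_left.1 (hM.2 D hDM A hAM hDA) h hiA
    have hDF : D ∈ F := by
      by_contra hDF
      exact hiD (key D (hM.1 hDM) hDF).1
    have hc : UV.compress {i} {j} D ∈ F := by
      have := hM.1 hDM
      rw [UV.mem_compression] at this
      exact (this.resolve_right fun h => h.1 hDF).2
    rw [compress_singleton hij] at hc
    split_ifs at hc with h
    · convert hc using 1
      ext x
      simp only [mem_image, mem_insert, mem_erase]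
      constructor
      · rintro ⟨y, hy, rfl⟩
        by_cases hyj : y = j
        · simp [hyj]
        · rw [Equiv.swap_apply_of_ne_of_ne (fun hyi : y = i => hiD (hyi ▸ hy)) hyj]
          exact Or.inr ⟨hyj, hy⟩
      · rintro (rfl | ⟨hxj, hx⟩)
        · exact ⟨j, h.1, by simp⟩
        · exact ⟨x, hx, Equiv.swap_apply_of_ne_of_ne (fun hxi : x = i => hiD (hxi ▸ hx)) hxj⟩
    · have hjD : j ∉ D := fun hj => h ⟨hj, hiD⟩
      convert hDF using 1
      refine (image_congr fun x hx => ?_).trans image_id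
      exact Equiv.swap_apply_of_ne_of_ne (fun h => hiD (h ▸ hx)) (fun h => hjD (h ▸ hx))
  · obtain ⟨B, hB, rfl⟩ := mem_image.1 hD
    obtain ⟨B', hB', rfl⟩ := mem_image.1 hD'
    exact (disjoint_image (Equiv.injective _)).2 (hM.2 B hB B' hB' fun h => hne (by rw [h]))

/-- The sum of all vertices over all edges, a potential that every effective downward shift
decreases. -/
def weight (F : Finset (Finset ℕ)) : ℕ := ∑ E ∈ F, ∑ x ∈ E, x

lemma weight_compression_lt {i j : ℕ} (hij : i < j) {F : Finset (Finset ℕ)} {E : Finset ℕ}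
    (hE : E ∈ F) (hj : j ∈ E) (hi : i ∉ E) (hc : insert i (E.erase j) ∉ F) :
    weight (𝓒 {i} {j} F) < weight F := by
  have hlt : ∀ D : Finset ℕ, UV.compress {i} {j} D ≠ D →
      ∑ x ∈ UV.compress {i} {j} D, x < ∑ x ∈ D, x := by
    intro D hD
    rw [compress_singleton hij.ne] at hD ⊢
    split_ifs at hD ⊢ with h
    · rw [sum_insert (by simp [h.2]), ← add_sum_erase D (fun x => x) h.1]
      omega
    · exact absurd rfl hD
  have himg : (F.image (UV.compress {i} {j})).filter (· ∉ F)
      = (F.filter fun D => UV.compress {i} {j} D ∉ F).image (UV.compress {i} {j}) := by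
    rw [filter_image]
  unfold weight UV.compression
  rw [sum_union UV.compress_disjoint, himg, sum_image UV.compress_injOn,
    ← sum_filter_add_sum_filter_not F (fun D => UV.compress {i} {j} D ∈ F)]
  refine Nat.add_lt_add_left (sum_lt_sum_of_nonempty ⟨E, ?_⟩ fun D hD => ?_) _
  · rw [mem_filter, compress_singleton hij.ne, if_pos ⟨hj, hi⟩]
    exact ⟨hE, hc⟩
  · refine hlt D fun h => ?_
    rw [mem_filter, h] at hD
    exact hD.2 hD.1

lemma exists_isMatching_allEdges {r n s : ℕ} (hr : 1 ≤ r) (hn : r * (s + 1) ≤ n) :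
    ∃ M, IsMatching (allEdges r n) M ∧ M.card = s + 1 := by
  set f : ℕ → Finset ℕ := fun i => Ioc (r * i) (r * (i + 1)) with hf
  have hd : ∀ a b, a < b → Disjoint (f a) (f b) := by
    intro a b hab
    refine disjoint_left.2 fun x hx hy => ?_
    have h1 := (mem_Ioc.1 hx).2
    have h2 := (mem_Ioc.1 hy).1
    have : r * (a + 1) ≤ r * b := Nat.mul_le_mul_left _ hab
    omega
  have hcard : ∀ i, (f i).card = r := fun i => by simp [hf, mul_add]
  obtain ⟨hM, hMc⟩ := isMatching_image (F := allEdges r n) (M := range (s + 1)) f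
    (fun i hi => by
      refine mem_allEdges.2 ⟨fun x hx => ?_, hcard i⟩
      have := mem_Ioc.1 hx
      have : r * (i + 1) ≤ r * (s + 1) := Nat.mul_le_mul_left _ (by simpa using hi)
      exact mem_Icc.2 ⟨by omega, by omega⟩)
    (fun i _ => card_pos.1 (by rw [hcard]; omega))
    (fun a _ b _ hab => (Nat.lt_or_gt_of_ne hab).elim (hd a b) fun h => (hd b a h).symm)
  exact ⟨_, hM, by rw [hMc, card_range]⟩

/-- Every stable `r`-graph with matching number at most `s` extends to a stable maximal one with
matching number exactly `s`, and the extension may be taken of the largest size among all (not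
necessarily stable) extensions with matching number at most `s`. -/
lemma exists_stable_maximal {r n s : ℕ} (hr : 1 ≤ r) (hn : r * (s + 1) ≤ n)
    {F : Finset (Finset ℕ)} (hF : IsStable r n F) (hs : matchingNumber F ≤ s) :
    ∃ G, F ⊆ G ∧ IsStable r n G ∧ matchingNumber G = s ∧ IsMaximal r n G ∧
      ∀ H ⊆ allEdges r n, F ⊆ H → matchingNumber H ≤ s → H.card ≤ G.card := by
  classical
  set 𝒢 := (allEdges r n).powerset.filter fun G => F ⊆ G ∧ matchingNumber G ≤ s with h𝒢
  have hmem : ∀ G, G ∈ 𝒢 ↔ G ⊆ allEdges r n ∧ F ⊆ G ∧ matchingNumber G ≤ s := by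
    intro G; rw [h𝒢, mem_filter, mem_powerset]
  obtain ⟨G₀, hG₀, hmax⟩ := exists_max_image 𝒢 Finset.card ⟨F, (hmem F).2 ⟨hF.1, Subset.rfl, hs⟩⟩
  obtain ⟨G, hG, hmin⟩ := exists_min_image (𝒢.filter fun G => G.card = G₀.card) weight
    ⟨G₀, mem_filter.2 ⟨hG₀, rfl⟩⟩
  obtain ⟨hG, hGc⟩ := mem_filter.1 hG
  obtain ⟨hGe, hFG, hGs⟩ := (hmem G).1 hG
  have hins : ∀ Q ∈ allEdges r n, Q ∉ G → s < matchingNumber (insert Q G) := by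
    intro Q hQ hQG
    by_contra hcon
    have h := hmax (insert Q G) ((hmem _).2 ⟨insert_subset hQ hGe,
      hFG.trans (subset_insert _ _), not_lt.1 hcon⟩)
    rw [card_insert_of_notMem hQG] at h
    omega
  have hν : matchingNumber G = s := by
    by_contra hne
    by_cases hall : allEdges r n ⊆ G
    · obtain ⟨M, hM, hMc⟩ := exists_isMatching_allEdges hr hn
      have := (hM.mono hall).card_le
      omega
    · obtain ⟨Q, hQ, hQG⟩ := not_subset.1 hall
      have h1 := hins Q hQ hQG
      have h2 := matchingNumber_insert_le G Q
      omega
  refine ⟨G, hFG, ShiftClosed.isStable hGe fun E hE j hj i hi hij hiE => ?_, hν, ?_, ?_⟩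
  · by_contra hcon
    have hlt := weight_compression_lt hij hE hj hiE hcon
    refine absurd (hmin (𝓒 {i} {j} G) (mem_filter.2 ⟨(hmem _).2 ⟨?_, ?_, ?_⟩, ?_⟩))
      (not_le.2 hlt)
    · intro D hD
      rw [UV.mem_compression] at hD
      rcases hD with hD | ⟨-, B, hB, rfl⟩
      · exact hGe hD.1
      · have hBe := mem_allEdges.1 (hGe hB)
        rw [compress_singleton hij.ne]
        split_ifs with h
        · have hjn := (mem_Icc.1 (hBe.1 h.1)).2
          refine mem_allEdges.2 ⟨insert_subset (mem_Icc.2 ⟨hi, by omega⟩)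
            ((erase_subset _ _).trans hBe.1), ?_⟩
          rw [card_insert_of_notMem (by simp [h.2]), card_erase_add_one h.1, hBe.2]
        · exact mem_allEdges.2 hBe
    · intro D hD
      rw [UV.mem_compression]
      refine Or.inl ⟨hFG hD, hFG ?_⟩
      rw [compress_singleton hij.ne]
      split_ifs with h
      · exact hF.shiftClosed D hD j h.1 i hi hij h.2
      · exact hD
    · exact (matchingNumber_compression_le hij.ne G).trans hGs
    · rw [UV.card_compression, hGc]
  · intro Q hQ hQG
    have h1 := hins Q hQ hQG
    have h2 := matchingNumber_insert_le G Q
    omega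
  · intro H hH hFH hHs
    rw [hGc]
    exact hmax H ((hmem H).2 ⟨hH, hFH, hHs⟩)

/-- For `n ≥ r (s + 1)` the maximum `m_r(n, s)` is attained by a stable maximal family. -/
lemma exists_stable_maximal_card_eq {r n s : ℕ} (hr : 1 ≤ r) (hn : r * (s + 1) ≤ n) :
    ∃ G, IsStable r n G ∧ matchingNumber G = s ∧ IsMaximal r n G ∧ G.card = maxEdges r n s := by
  have h0 : IsStable r n ∅ := ⟨empty_subset _, by simp⟩
  have h0s : matchingNumber ∅ ≤ s := by
    refine matchingNumber_le_iff.2 fun M hM => ?_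
    simp [subset_empty.1 hM.1]
  obtain ⟨G, -, h1, h2, h3, h4⟩ := exists_stable_maximal hr hn h0 h0s
  exact ⟨G, h1, h2, h3, le_antisymm (card_le_maxEdges h1.1 h2.le)
    (maxEdges_le_iff.2 fun H hH hs => h4 H hH (empty_subset _) hs)⟩

/-! ### Deletions, links and compressed matchings of stable families -/

lemma IsStable.restrict {r m n : ℕ} {F : Finset (Finset ℕ)} (hF : IsStable r n F) (h : m ≤ n) :
    IsStable r m (F.filter (· ⊆ Icc 1 m)) := by
  refine ⟨fun E hE => ?_, fun B hB A hA hAB => ?_⟩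
  · rw [mem_filter] at hE
    exact mem_allEdges.2 ⟨hE.2, (mem_allEdges.1 (hF.1 hE.1)).2⟩
  · exact mem_filter.2 ⟨hF.2 B (mem_filter.1 hB).1 A (allEdges_mono h hA) hAB,
      (mem_allEdges.1 hA).1⟩

/-- A matching of a stable family that avoids vertex `1` can be pushed down, along the increasing
bijection, onto the interval that starts at `2`. -/
lemma IsStable.exists_compressed_matching {r n : ℕ} (hr : 1 ≤ r) {F M : Finset (Finset ℕ)}
    (hF : IsStable r n F) (hM : IsMatching F M) (h1 : ∀ E ∈ M, 1 ∉ E) :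
    ∃ N, IsMatching F N ∧ N.card = M.card ∧ ∀ E ∈ N, E ⊆ Icc 2 (r * M.card + 1) := by
  classical
  have hMr : ∀ E ∈ M, E.card = r := fun E hE => (mem_allEdges.1 (hF.1 (hM.1 hE))).2
  set U := M.biUnion id with hU
  have hUc : U.card = r * M.card := by rw [hU, card_biUnion_of_isMatching hM hMr, mul_comm]
  have hU2 : ∀ x ∈ U, 2 ≤ x := by
    intro x hx
    obtain ⟨E, hE, hxE⟩ := mem_biUnion.1 hx
    have := mem_Icc.1 ((mem_allEdges.1 (hF.1 (hM.1 hE))).1 hxE)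
    have : x ≠ 1 := fun h => h1 E hE (h ▸ hxE)
    omega
  -- the increasing bijection of `U` onto `[2, |U| + 1]`
  set f : ℕ → ℕ := fun x => (U.filter (· < x)).card + 2 with hf
  have hlt : ∀ x ∈ U, ∀ y, x < y → f x < f y := by
    intro x hx y hxy
    refine Nat.add_lt_add_right (card_lt_card ((ssubset_iff_of_subset fun z hz => ?_).2
      ⟨x, by simp [hx, hxy], by simp⟩)) 2
    rw [mem_filter] at hz ⊢
    exact ⟨hz.1, hz.2.trans hxy⟩
  have hinj : Set.InjOn f U := by
    intro x hx y hy hxy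
    rcases lt_trichotomy x y with h | h | h
    · exact absurd hxy (hlt x hx y h).ne
    · exact h
    · exact absurd hxy (hlt y hy x h).ne'
  have hle : ∀ x ∈ U, f x ≤ x := by
    intro x hx
    have hsub : U.filter (· < x) ⊆ Ico 2 x := fun z hz => by
      rw [mem_filter] at hz
      exact mem_Ico.2 ⟨hU2 z hz.1, hz.2⟩
    have := card_le_card hsub
    have := hU2 x hx
    rw [Nat.card_Ico] at *
    simp only [hf]
    omega
  have hEU : ∀ E ∈ M, E ⊆ U := fun E hE => subset_biUnion_of_mem id hE
  obtain ⟨hN, hNc⟩ := isMatching_image (F := F) (M := M) (fun E => E.image f)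
    (fun E hE => hF.image_mem (hM.1 hE) f (hinj.mono (hEU E hE)) fun x hx =>
      ⟨by simp only [hf]; omega, hle x (hEU E hE hx)⟩)
    (fun E hE => (card_pos.1 (by rw [hMr E hE]; omega)).image f)
    (fun A hA B hB hAB => by
      refine disjoint_left.2 fun y hy hy' => ?_
      obtain ⟨a, ha, rfl⟩ := mem_image.1 hy
      obtain ⟨b, hb, hba⟩ := mem_image.1 hy'
      have := hinj (hEU B hB hb) (hEU A hA ha) hba
      subst this
      exact disjoint_left.1 (hM.2 A hA B hB hAB) ha hb)
  refine ⟨_, hN, hNc, fun E hE y hy => ?_⟩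
  obtain ⟨D, hD, rfl⟩ := mem_image.1 hE
  obtain ⟨x, hx, rfl⟩ := mem_image.1 hy
  have : (U.filter (· < x)).card < U.card := card_lt_card
    (filter_ssubset.2 ⟨x, hEU D hD hx, by simp⟩)
  exact mem_Icc.2 ⟨by simp only [hf]; omega, by simp only [hf]; omega⟩

/-- Property ONE survives restriction to an initial segment followed by enlargement, as long as
the matching number does not change. -/
lemma IsStable.hasOne_of_restrict_subset {r m n s : ℕ} (hr : 1 ≤ r) {F G : Finset (Finset ℕ)}
    (hF : IsStable r n F) (hFs : matchingNumber F = s) (hone : HasOne F) (hm : r * s + 1 ≤ m)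
    (hFG : F.filter (· ⊆ Icc 1 m) ⊆ G) (hG : matchingNumber G = s) : HasOne G := by
  obtain ⟨M, hM, hMc, hM1⟩ := hone
  obtain ⟨N, hN, hNc, hN2⟩ := hF.exists_compressed_matching hr hM hM1
  rw [hMc, hFs] at hN2
  refine ⟨N, ⟨fun E hE => hFG (mem_filter.2 ⟨hN.1 hE, (hN2 E hE).trans ?_⟩), hN.2⟩,
    by rw [hNc, hMc, hFs, hG], fun E hE h => ?_⟩
  · exact Icc_subset_Icc (by omega) hm
  · have := mem_Icc.1 (hN2 E hE h)
    omega

/-- The link of the vertex `v`. -/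
def link (v : ℕ) (F : Finset (Finset ℕ)) : Finset (Finset ℕ) :=
  (F.filter (v ∈ ·)).image (fun E => E.erase v)

lemma mem_link {v : ℕ} {F : Finset (Finset ℕ)} {H : Finset ℕ} :
    H ∈ link v F ↔ v ∉ H ∧ insert v H ∈ F := by
  simp only [link, mem_image, mem_filter]
  constructor
  · rintro ⟨E, ⟨hE, hv⟩, rfl⟩
    exact ⟨notMem_erase _ _, by rwa [insert_erase hv]⟩
  · rintro ⟨hv, h⟩
    exact ⟨_, ⟨h, mem_insert_self _ _⟩, erase_insert hv⟩

lemma card_link (v : ℕ) (F : Finset (Finset ℕ)) :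
    (link v F).card = (F.filter (v ∈ ·)).card := by
  refine card_image_of_injOn fun A hA B hB h => ?_
  have hA' := (mem_filter.1 (mem_coe.1 hA)).2
  have hB' := (mem_filter.1 (mem_coe.1 hB)).2
  rw [← insert_erase hA', ← insert_erase hB']
  exact congrArg _ h

lemma card_eq_card_filter_add_card_link (v : ℕ) (F : Finset (Finset ℕ)) :
    F.card = (F.filter (v ∉ ·)).card + (link v F).card := by
  rw [card_link, add_comm, card_filter_add_card_filter_not]

/-- In a shifted family on an interval with at least `k (s + 1)` elements, the link of the last
vertex has matching number at most that of the family: the last vertex can be replaced by distinct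
vertices outside a given matching of the link. -/
lemma matchingNumber_link_le {lo hi k s : ℕ} (hk : 2 ≤ k) {F : Finset (Finset ℕ)}
    (hF : F ⊆ powersetCard k (Icc lo hi)) (hsh : ShiftClosed lo F)
    (hs : matchingNumber F ≤ s) (hn : k * (s + 1) ≤ (Icc lo hi).card) :
    matchingNumber (link hi F) ≤ s := by
  classical
  refine matchingNumber_le_iff.2 fun M' hM' => ?_
  by_contra hcon
  obtain ⟨M, hMM', hMc⟩ := exists_subset_card_eq (show s + 1 ≤ M'.card by omega)
  have hM := hM'.subset hMM'
  have hcard : ∀ H ∈ M, H.card = k - 1 := by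
    intro H hH
    obtain ⟨h1, h2⟩ := mem_link.1 (hM.1 hH)
    have := (mem_powersetCard.1 (hF h2)).2
    rw [card_insert_of_notMem h1] at this
    omega
  have hUc := card_biUnion_of_isMatching hM hcard
  set U := M.biUnion id with hU
  have hfree : M.card ≤ (Icc lo hi \ U).card := by
    have h1 := le_card_sdiff U (Icc lo hi)
    have h2 : k * (s + 1) = (s + 1) * (k - 1) + (s + 1) := by
      obtain ⟨k, rfl⟩ := Nat.exists_eq_add_of_le hk
      rw [show 2 + k - 1 = k + 1 by omega]; ring
    rw [hMc] at hUc ⊢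
    omega
  obtain ⟨T, hT, hTc⟩ := exists_subset_card_eq hfree
  obtain e := Finset.equivOfCardEq hTc.symm
  let y : Finset ℕ → ℕ := fun H => if h : H ∈ M then (e ⟨H, h⟩ : ℕ) else 0
  have hy : ∀ H (h : H ∈ M), y H = e ⟨H, h⟩ := fun H h => dif_pos h
  have hyT : ∀ H ∈ M, y H ∈ Icc lo hi ∧ y H ∉ U := fun H h => by
    rw [hy H h]
    exact mem_sdiff.1 (hT (e ⟨H, h⟩).2)
  have hHU : ∀ H ∈ M, H ⊆ U := fun H hH => subset_biUnion_of_mem id hH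
  obtain ⟨hN, hNc⟩ := isMatching_image (F := F) (M := M) (fun H => insert (y H) H)
    (fun H hH => by
      obtain ⟨h1, h2⟩ := mem_link.1 (hM.1 hH)
      obtain ⟨h3, h4⟩ := hyT H hH
      rw [mem_Icc] at h3
      by_cases hyh : y H = hi
      · rwa [hyh]
      · have := hsh _ h2 hi (mem_insert_self _ _) (y H) h3.1 (by omega)
          (by simp only [mem_insert, not_or]; exact ⟨hyh, fun h => h4 (hHU H hH h)⟩)
        rwa [erase_insert h1] at this)
    (fun H _ => insert_nonempty _ _)
    (fun A hA B hB hAB => by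
      have hyne : y A ≠ y B := by
        rw [hy A hA, hy B hB]
        intro h
        exact hAB (by simpa using e.injective (Subtype.ext h))
      simp only [disjoint_insert_left, disjoint_insert_right, mem_insert, not_or]
      exact ⟨⟨hyne.symm, fun h => (hyT B hB).2 (hHU A hA h)⟩,
        fun h => (hyT A hA).2 (hHU B hB h), hM.2 A hA B hB hAB⟩)
  have := hN.card_le
  omega

/-! ### The cover term -/

lemma coverTerm_succ_left {r n s : ℕ} (hr : 1 ≤ r) (hs : s ≤ n) :
    coverTerm r (n + 1) s = coverTerm r n s + coverTerm (r - 1) n s := by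
  obtain ⟨r, rfl⟩ := Nat.exists_eq_add_of_le' hr
  unfold coverTerm
  rw [Nat.succ_sub hs, Nat.choose_succ_succ', Nat.choose_succ_succ', Nat.add_sub_cancel]
  have h1 := Nat.choose_le_choose r (Nat.sub_le n s)
  have h2 := Nat.choose_le_choose (r + 1) (Nat.sub_le n s)
  omega

lemma coverTerm_succ_succ {r n s : ℕ} (hr : 1 ≤ r) :
    coverTerm r (n + 1) (s + 1) = coverTerm r n s + n.choose (r - 1) := by
  obtain ⟨r, rfl⟩ := Nat.exists_eq_add_of_le' hr
  unfold coverTerm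
  rw [Nat.succ_sub_succ, Nat.choose_succ_succ', Nat.add_sub_cancel]
  have h2 := Nat.choose_le_choose (r + 1) (Nat.sub_le n s)
  omega

lemma le_coverTerm_iff {N r n s : ℕ} :
    N ≤ coverTerm r n s ↔ N + (n - s).choose r ≤ n.choose r := by
  have h := Nat.choose_le_choose r (Nat.sub_le n s)
  unfold coverTerm
  omega

/-! ### The two extremal constructions -/

lemma cliqueTerm_le_maxEdges {r n s : ℕ} (hr : 1 ≤ r) (hn : r * s + r - 1 ≤ n) :
    cliqueTerm r s ≤ maxEdges r n s := by
  rw [cliqueTerm, ← card_allEdges]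
  refine card_le_maxEdges (allEdges_mono hn) (matchingNumber_le_iff.2 fun M hM => ?_)
  have hc := card_biUnion_of_isMatching hM fun E hE => (mem_allEdges.1 (hM.1 hE)).2
  have hsub : M.biUnion id ⊆ Icc 1 (r * s + r - 1) :=
    biUnion_subset.2 fun E hE => (mem_allEdges.1 (hM.1 hE)).1
  have hle := card_le_card hsub
  rw [hc, Nat.card_Icc] at hle
  by_contra hcon
  have : (s + 1) * r ≤ M.card * r := Nat.mul_le_mul_right _ (by omega)
  rw [add_mul, mul_comm s r] at this
  omega

lemma card_filter_not_disjoint {r n s : ℕ} (hs : s ≤ n) :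
    ((allEdges r n).filter fun E => ¬ Disjoint E (Icc 1 s)).card = coverTerm r n s := by
  have h : (allEdges r n).filter (fun E => Disjoint E (Icc 1 s))
      = powersetCard r (Icc (s + 1) n) := by
    ext E
    rw [mem_filter, mem_allEdges, mem_powersetCard]
    constructor
    · rintro ⟨⟨h1, h2⟩, h3⟩
      refine ⟨fun x hx => ?_, h2⟩
      have hx1 := mem_Icc.1 (h1 hx)
      have hx2 := disjoint_left.1 h3 hx
      rw [mem_Icc] at hx2 ⊢
      omega
    · rintro ⟨h1, h2⟩
      refine ⟨⟨h1.trans (Icc_subset_Icc_left (by omega)), h2⟩, disjoint_left.2 fun x hx hx' => ?_⟩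
      have := mem_Icc.1 (h1 hx)
      have := mem_Icc.1 hx'
      omega
  have h2 := card_filter_add_card_filter_not (s := allEdges r n) (fun E => Disjoint E (Icc 1 s))
  rw [h, card_powersetCard, card_allEdges, Nat.card_Icc,
    show n + 1 - (s + 1) = n - s by omega] at h2
  unfold coverTerm
  omega

lemma coverTerm_le_maxEdges {r n s : ℕ} (hs : s ≤ n) :
    coverTerm r n s ≤ maxEdges r n s := by
  rw [← card_filter_not_disjoint hs]
  refine card_le_maxEdges (filter_subset _ _) (matchingNumber_le_iff.2 fun M hM => ?_)
  have hex : ∀ E ∈ M, ∃ x, x ∈ E ∧ x ∈ Icc 1 s := fun E hE =>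
    not_disjoint_iff.1 (mem_filter.1 (hM.1 hE)).2
  choose! f hf hfs using hex
  have := card_le_card_of_injOn f hfs fun A hA B hB hAB => by
    by_contra hne
    exact disjoint_left.1 (hM.2 A hA B hB hne) (hf A hA) (hAB ▸ hf B hB)
  simpa using this

/-! ### Families without property ONE -/

/-- If every maximum matching of a stable family uses vertex `1`, deleting that vertex lowers the
matching number. -/
lemma card_le_of_not_hasOne {r n s : ℕ} (hr : 1 ≤ r) {F : Finset (Finset ℕ)}
    (hF : F ⊆ allEdges r (n + 1)) (hs : matchingNumber F = s + 1) (hone : ¬ HasOne F) :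
    F.card ≤ maxEdges r n s + n.choose (r - 1) := by
  classical
  rw [card_eq_card_filter_add_card_link 1]
  refine Nat.add_le_add ?_ ?_
  · -- relabel the vertices `2, …, n + 1` as `1, …, n`
    have hinj : Set.InjOn (fun E : Finset ℕ => E.image (· - 1)) (F.filter (1 ∉ ·)) := by
      intro A hA B hB hAB
      have hrec : ∀ D ∈ F.filter (1 ∉ ·), (D.image (· - 1)).image (· + 1) = D := by
        intro D hD
        rw [mem_filter] at hD
        rw [image_image]
        refine (image_congr fun x hx => ?_).trans image_id
        have := mem_Icc.1 ((mem_allEdges.1 (hF hD.1)).1 hx)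
        simp only [Function.comp_apply, id]
        omega
      rw [← hrec A hA, ← hrec B hB]
      exact congrArg _ hAB
    rw [← card_image_of_injOn hinj]
    have hcoord : ∀ D ∈ F.filter (1 ∉ ·), ∀ x ∈ D, 2 ≤ x ∧ x ≤ n + 1 := by
      intro D hD x hx
      rw [mem_filter] at hD
      have := mem_Icc.1 ((mem_allEdges.1 (hF hD.1)).1 hx)
      have : x ≠ 1 := fun h => hD.2 (h ▸ hx)
      omega
    refine card_le_maxEdges (fun E hE => ?_) (matchingNumber_le_iff.2 fun M hM => ?_)
    · obtain ⟨D, hD, rfl⟩ := mem_image.1 hE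
      refine mem_allEdges.2 ⟨fun x hx => ?_, ?_⟩
      · obtain ⟨y, hy, rfl⟩ := mem_image.1 hx
        have := hcoord D hD y hy
        exact mem_Icc.2 (by omega)
      · rw [card_image_of_injOn, (mem_allEdges.1 (hF (mem_filter.1 hD).1)).2]
        intro x hx y hy hxy
        have := hcoord D hD x hx
        have := hcoord D hD y hy
        simp only at hxy
        omega
    · obtain ⟨hN, hNc⟩ := isMatching_image (F := F.filter (1 ∉ ·)) (M := M)
        (fun E => E.image (· + 1))
        (fun E hE => by
          obtain ⟨D, hD, rfl⟩ := mem_image.1 (hM.1 hE)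
          have : (D.image (· - 1)).image (· + 1) = D := by
            rw [image_image]
            refine (image_congr fun x hx => ?_).trans image_id
            have := hcoord D hD x hx
            simp only [Function.comp_apply, id]
            omega
          rwa [this])
        (fun E hE => by
          obtain ⟨D, hD, rfl⟩ := mem_image.1 (hM.1 hE)
          refine Nonempty.image (Nonempty.image (card_pos.1 ?_) _) _
          rw [(mem_allEdges.1 (hF (mem_filter.1 hD).1)).2]
          omega)
        (fun A hA B hB hAB =>
          (disjoint_image (add_left_injective 1)).2 (hM.2 A hA B hB hAB))
      have hle := (hN.mono (filter_subset _ F)).card_le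
      by_contra hcon
      exact hone ⟨_, hN.mono (filter_subset _ F), by omega,
        fun E hE => (mem_filter.1 (hN.1 hE)).2⟩
  · have hsub : link 1 F ⊆ powersetCard (r - 1) (Icc 2 (n + 1)) := by
      intro H hH
      obtain ⟨h1, h2⟩ := mem_link.1 hH
      obtain ⟨h3, h4⟩ := mem_allEdges.1 (hF h2)
      rw [card_insert_of_notMem h1] at h4
      refine mem_powersetCard.2 ⟨fun x hx => ?_, by omega⟩
      have := mem_Icc.1 (h3 (mem_insert_of_mem hx))
      have : x ≠ 1 := fun h => h1 (h ▸ hx)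
      exact mem_Icc.2 (by omega)
    have := card_le_card hsub
    rwa [card_powersetCard, Nat.card_Icc, show n + 1 + 1 - 2 = n by omega] at this

/-! ### Shadows of shifted families with small matching number -/

lemma card_mul_le_card_shadow_mul {k : ℕ} {U : Finset ℕ} {F : Finset (Finset ℕ)}
    (hF : F ⊆ powersetCard k U) (hk : 1 ≤ k) :
    F.card * k ≤ (∂ F).card * (U.card - (k - 1)) := by
  refine card_mul_le_card_mul (fun E D => D ⊆ E) (fun E hE => ?_) fun D hD => ?_
  · have hEk := (mem_powersetCard.1 (hF hE)).2
    rw [← hEk, ← card_image_of_injOn (erase_injOn E)]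
    refine card_le_card fun D hD => ?_
    obtain ⟨x, hx, rfl⟩ := mem_image.1 hD
    rw [mem_bipartiteAbove]
    exact ⟨erase_mem_shadow hE hx, erase_subset _ _⟩
  · obtain ⟨E, hE, x, hx, hD'⟩ := mem_shadow_iff.1 hD
    have hEk := mem_powersetCard.1 (hF hE)
    have hDc : D.card = k - 1 := by rw [← hD', card_erase_of_mem hx, hEk.2]
    have hDU : D ⊆ U := by rw [← hD']; exact (erase_subset _ _).trans hEk.1
    rw [← hDc, ← card_sdiff_of_subset hDU]
    refine le_trans (card_le_card fun E' hE' => ?_) (card_image_le (f := fun y => insert y D))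
    rw [mem_bipartiteBelow] at hE'
    have hE'k := mem_powersetCard.1 (hF hE'.1)
    have h1 : (E' \ D).card = 1 := by rw [card_sdiff_of_subset hE'.2, hE'k.2, hDc]; omega
    obtain ⟨y, hy⟩ := card_eq_one.1 h1
    have hyE : y ∈ E' \ D := by rw [hy]; exact mem_singleton_self y
    rw [mem_sdiff] at hyE
    refine mem_image.2 ⟨y, mem_sdiff.2 ⟨hE'k.1 hyE.1, hyE.2⟩, ?_⟩
    rw [insert_eq, ← hy, sdiff_union_of_subset hE'.2]

/-- A shifted `k`-uniform family with matching number at most `s` has at most `s` times as many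
members as its shadow. On few vertices this is a double count; otherwise delete the last vertex and
use that its link again has matching number at most `s`. -/
lemma card_le_mul_card_shadow {lo hi k s : ℕ} (hk : 1 ≤ k) {F : Finset (Finset ℕ)}
    (hF : F ⊆ powersetCard k (Icc lo hi)) (hsh : ShiftClosed lo F)
    (hs : matchingNumber F ≤ s) : F.card ≤ s * (∂ F).card := by
  classical
  induction hi generalizing k F with
  | zero =>
    rcases F.eq_empty_or_nonempty with rfl | ⟨E, hE⟩
    · simp
    have h := card_mul_le_card_shadow_mul hF hk
    have hEk := mem_powersetCard.1 (hF hE)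
    have hc := card_le_card hEk.1
    rw [hEk.2, Nat.card_Icc] at hc
    have hk1 : k = 1 := by omega
    have hs1 : 1 ≤ s := by
      refine le_trans ?_ hs
      refine IsMatching.card_le (M := {E}) ⟨by simpa using hE, ?_⟩
      simp
    subst hk1
    have : (Icc lo 0).card ≤ 1 := by rw [Nat.card_Icc]; omega
    have h3 : (∂ F).card * ((Icc lo 0).card - (1 - 1)) ≤ (∂ F).card * 1 :=
      Nat.mul_le_mul_left _ (by omega)
    have h4 := Nat.mul_le_mul_right (∂ F).card hs1
    omega
  | succ h ih =>
    by_cases hsmall : (Icc lo (h + 1)).card < k * (s + 1)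
    · have h1 := card_mul_le_card_shadow_mul hF hk
      have h2 : (Icc lo (h + 1)).card - (k - 1) ≤ s * k := by
        rw [mul_add, mul_comm k s] at hsmall
        omega
      have h3 := h1.trans (Nat.mul_le_mul_left _ h2)
      refine Nat.le_of_mul_le_mul_right (h3.trans (le_of_eq ?_)) hk
      ring
    push Not at hsmall
    rcases hk.eq_or_lt with rfl | hk2
    · -- distinct singletons are disjoint, so `F` itself is a matching
      rcases F.eq_empty_or_nonempty with rfl | ⟨E, hE⟩
      · simp
      have hM : IsMatching F F := by
        refine ⟨Subset.rfl, fun A hA B hB hAB => ?_⟩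
        obtain ⟨a, rfl⟩ := card_eq_one.1 (mem_powersetCard.1 (hF hA)).2
        obtain ⟨b, rfl⟩ := card_eq_one.1 (mem_powersetCard.1 (hF hB)).2
        rw [disjoint_singleton]
        rintro rfl
        exact hAB rfl
      obtain ⟨a, rfl⟩ := card_eq_one.1 (mem_powersetCard.1 (hF hE)).2
      have hpos : 1 ≤ (∂ F).card :=
        card_pos.2 ⟨_, erase_mem_shadow hE (mem_singleton_self a)⟩
      exact (hM.card_le.trans hs).trans (Nat.le_mul_of_pos_right _ hpos)
    have hlo : lo ≤ h + 1 := by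
      by_contra hcon
      rw [Icc_eq_empty (by omega), card_empty] at hsmall
      have : 0 < k * (s + 1) := by positivity
      omega
    have hF0 : F.filter (h + 1 ∉ ·) ⊆ powersetCard k (Icc lo h) := fun E hE => by
      rw [mem_filter] at hE
      obtain ⟨h1, h2⟩ := mem_powersetCard.1 (hF hE.1)
      refine mem_powersetCard.2 ⟨fun x hx => ?_, h2⟩
      have := mem_Icc.1 (h1 hx)
      have : x ≠ h + 1 := fun hxh => hE.2 (hxh ▸ hx)
      exact mem_Icc.2 (by omega)
    have hF1 : link (h + 1) F ⊆ powersetCard (k - 1) (Icc lo h) := fun H hH => by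
      obtain ⟨h1, h2⟩ := mem_link.1 hH
      obtain ⟨h3, h4⟩ := mem_powersetCard.1 (hF h2)
      rw [card_insert_of_notMem h1] at h4
      refine mem_powersetCard.2 ⟨fun x hx => ?_, by omega⟩
      have := mem_Icc.1 (h3 (mem_insert_of_mem hx))
      have : x ≠ h + 1 := fun hxh => h1 (hxh ▸ hx)
      exact mem_Icc.2 (by omega)
    have hsh0 : ShiftClosed lo (F.filter (h + 1 ∉ ·)) := by
      intro E hE j hj i hi hij hiE
      have hjh := mem_Icc.1 ((mem_powersetCard.1 (hF0 hE)).1 hj)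
      rw [mem_filter] at hE ⊢
      refine ⟨hsh E hE.1 j hj i hi hij hiE, ?_⟩
      rw [mem_insert, mem_erase]
      rintro (h' | h')
      · omega
      · exact hE.2 h'.2
    have hsh1 : ShiftClosed lo (link (h + 1) F) := by
      intro H hH j hj i hi hij hiH
      have hjh := mem_Icc.1 ((mem_powersetCard.1 (hF1 hH)).1 hj)
      obtain ⟨h1, h2⟩ := mem_link.1 hH
      have := hsh _ h2 j (mem_insert_of_mem hj) i hi hij (by
        rw [mem_insert, not_or]; exact ⟨by omega, hiH⟩)
      rw [erase_insert_of_ne (by omega), insert_comm] at this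
      refine mem_link.2 ⟨?_, this⟩
      rw [mem_insert, mem_erase]
      rintro (h' | h')
      · omega
      · exact h1 h'.2
    have i0 := ih hk hF0 hsh0 ((matchingNumber_mono (filter_subset _ _)).trans hs)
    have i1 := ih (by omega : 1 ≤ k - 1) hF1 hsh1 (matchingNumber_link_le hk2 hF hsh hs hsmall)
    have hnot : ∀ D ∈ ∂ (link (h + 1) F), h + 1 ∉ D := fun D hD => by
      obtain ⟨E, hE, hDE⟩ := exists_subset_of_mem_shadow hD
      exact fun hc => (mem_link.1 hE).1 (hDE hc)
    have hdisj : Disjoint (∂ (F.filter (h + 1 ∉ ·)))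
        ((∂ (link (h + 1) F)).image (insert (h + 1))) := by
      refine disjoint_left.2 fun D hD hD' => ?_
      obtain ⟨E, hE, hDE⟩ := exists_subset_of_mem_shadow hD
      obtain ⟨D', -, rfl⟩ := mem_image.1 hD'
      exact (mem_filter.1 hE).2 (hDE (mem_insert_self _ _))
    have hsub : ∂ (F.filter (h + 1 ∉ ·)) ∪ (∂ (link (h + 1) F)).image (insert (h + 1)) ⊆ ∂ F := by
      refine union_subset (shadow_mono (filter_subset _ _)) fun D hD => ?_
      obtain ⟨D', hD', rfl⟩ := mem_image.1 hD
      obtain ⟨H, hH, x, hx, rfl⟩ := mem_shadow_iff.1 hD'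
      obtain ⟨h1, h2⟩ := mem_link.1 hH
      rw [← erase_insert_of_ne (fun hxh : h + 1 = x => h1 (hxh ▸ hx))]
      exact erase_mem_shadow h2 (mem_insert_of_mem hx)
    have hc := card_le_card hsub
    rw [card_union_of_disjoint hdisj, card_image_of_injOn] at hc
    · rw [card_eq_card_filter_add_card_link (h + 1) F]
      calc _ ≤ _ := Nat.add_le_add i0 i1
        _ = s * ((∂ (F.filter (h + 1 ∉ ·))).card + (∂ (link (h + 1) F)).card) := by ring
        _ ≤ _ := Nat.mul_le_mul_left _ hc
    · intro A hA B hB hAB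
      rw [← erase_insert (hnot A hA), ← erase_insert (hnot B hB)]
      exact congrArg (fun D => erase D (h + 1)) hAB

/-! ### Nested cross-dependent families -/

section CrossDependent

variable {α : Type*} [Fintype α] [DecidableEq α]

lemma exists_perm_image_eq {A B : Finset α} (h : A.card = B.card) :
    ∃ π : Equiv.Perm α, A.image π = B := by
  have e : {x // x ∈ A} ≃ {x // x ∈ B} := Finset.equivOfCardEq h
  refine ⟨e.extendSubtype, eq_of_subset_of_card_le (fun y hy => ?_) ?_⟩
  · obtain ⟨x, hx, rfl⟩ := mem_image.1 hy
    exact e.extendSubtype_mem x hx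
  · rw [card_image_of_injective _ (Equiv.injective _), h]

/-- A uniformly random permutation maps a fixed `l`-set to a uniformly random `l`-set. -/
lemma card_perm_image_mem_mul_choose {l : ℕ} {D : Finset α} (hD : D.card = l)
    {𝒢 : Finset (Finset α)} (h𝒢 : 𝒢 ⊆ powersetCard l univ) :
    (univ.filter fun σ : Equiv.Perm α => D.image σ ∈ 𝒢).card * (Fintype.card α).choose l
      = 𝒢.card * Fintype.card (Equiv.Perm α) := by
  set c : Finset α → ℕ := fun B => (univ.filter fun σ : Equiv.Perm α => D.image σ = B).card with hc
  have hconst : ∀ B, B.card = l → c B = c D := by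
    intro B hB
    obtain ⟨π, hπ⟩ := exists_perm_image_eq (hD.trans hB.symm)
    refine (card_bij (fun σ _ => π * σ) (fun σ hσ => ?_) (fun σ _ τ _ h => mul_left_cancel h)
      fun σ hσ => ⟨π⁻¹ * σ, ?_, by simp⟩).symm
    · rw [mem_filter] at hσ ⊢
      refine ⟨mem_univ _, ?_⟩
      rw [Equiv.Perm.coe_mul, ← image_image, hσ.2, hπ]
    · rw [mem_filter] at hσ ⊢
      refine ⟨mem_univ _, ?_⟩
      rw [Equiv.Perm.coe_mul, ← image_image, hσ.2, ← hπ, image_image, ← Equiv.Perm.coe_mul]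
      simp
  have hfib : ∀ 𝒜 ⊆ powersetCard l (univ : Finset α),
      (univ.filter fun σ : Equiv.Perm α => D.image σ ∈ 𝒜).card = 𝒜.card * c D := by
    intro 𝒜 h𝒜
    rw [card_eq_sum_card_fiberwise (f := fun σ : Equiv.Perm α => D.image σ)
      (s := univ.filter fun σ : Equiv.Perm α => D.image σ ∈ 𝒜) (t := 𝒜)
      (fun σ hσ => (mem_filter.1 (mem_coe.1 hσ)).2), ← smul_eq_mul, ← sum_const]
    refine sum_congr rfl fun B hB => ?_
    rw [← hconst B (mem_powersetCard.1 (h𝒜 hB)).2, hc, filter_filter]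
    refine congrArg card (filter_congr fun σ _ => ?_)
    exact ⟨fun h => h.2, fun h => ⟨h ▸ hB, h⟩⟩
  have hall := hfib _ Subset.rfl
  rw [filter_true_of_mem (fun σ _ => mem_powersetCard.2 ⟨subset_univ _, by
    rw [card_image_of_injective _ (Equiv.injective _), hD]⟩), card_univ, card_powersetCard,
    card_univ] at hall
  rw [hfib 𝒢 h𝒢, hall]
  ring

/-- If the sets `J₀, …, J_s` have no system of distinct representatives, then some `J_i` has
at most `s - i` elements. -/
lemma exists_card_le_of_no_representatives {β : Type*} [DecidableEq β] {s : ℕ} (J : ℕ → Finset β)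
    (hno : ¬ ∃ f : Fin (s + 1) → β, Function.Injective f ∧ ∀ i : Fin (s + 1), f i ∈ J i) :
    ∃ i ≤ s, (J i).card ≤ s - i := by
  by_contra hcon
  push Not at hcon
  refine hno ((all_card_le_biUnion_card_iff_exists_injective
    fun i : Fin (s + 1) => J i).1 fun S => ?_)
  rcases S.eq_empty_or_nonempty with rfl | hS
  · simp
  set m := S.min' hS
  have h1 : S.card ≤ s + 1 - m := by
    rw [← Fin.card_Ici]
    exact card_le_card fun i hi => mem_Ici.2 (S.min'_le i hi)
  have h2 := hcon m (by omega)
  have h3 : (J m).card ≤ (S.biUnion fun i : Fin (s + 1) => J i).card :=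
    card_le_card (subset_biUnion_of_mem (fun i : Fin (s + 1) => J i) (S.min'_mem hS))
  omega

/-- Nested families `𝒢₀ ⊇ ⋯ ⊇ 𝒢_s` of `l`-sets that do not contain pairwise disjoint
representatives are small in a weighted sense. The inequality holds for the traces of the families
on any `2s + 1` disjoint `l`-sets, and the claim follows by averaging over all permutations. -/
lemma sum_card_le_of_crossDependent {s l : ℕ} (hα : (2 * s + 1) * l ≤ Fintype.card α)
    (𝒢 : ℕ → Finset (Finset α)) (h𝒢 : ∀ i, 𝒢 i ⊆ powersetCard l univ)
    (hnest : ∀ i j, i ≤ j → j ≤ s → 𝒢 j ⊆ 𝒢 i)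
    (hcross : ¬ ∃ D : Fin (s + 1) → Finset α, (∀ i : Fin (s + 1), D i ∈ 𝒢 i) ∧
      ∀ i j, i ≠ j → Disjoint (D i) (D j)) :
    ∑ i ∈ range s, (𝒢 i).card + (s + 1) * (𝒢 s).card ≤ s * (Fintype.card α).choose l := by
  -- `2s + 1` disjoint `l`-sets
  obtain ⟨e⟩ : Nonempty (Fin (2 * s + 1) × Fin l ↪ α) :=
    Function.Embedding.nonempty_of_card_le (by simpa using hα)
  set D : Fin (2 * s + 1) → Finset α := fun j => univ.map ((Function.Embedding.sectR j _).trans e)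
    with hD
  have hDc : ∀ j, (D j).card = l := fun j => by simp [hD]
  have hDd : ∀ i j, i ≠ j → Disjoint (D i) (D j) := by
    intro i j hij
    refine disjoint_left.2 fun x hx hx' => ?_
    obtain ⟨a, -, rfl⟩ := mem_map.1 hx
    obtain ⟨b, -, hb⟩ := mem_map.1 hx'
    have := e.injective hb
    simp at this
    exact hij this.1.symm
  set J : Equiv.Perm α → ℕ → Finset (Fin (2 * s + 1)) :=
    fun σ i => univ.filter fun j => (D j).image σ ∈ 𝒢 i with hJ
  have hJle : ∀ σ i, (J σ i).card ≤ 2 * s + 1 := fun σ i =>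
    (card_le_univ _).trans (by simp)
  have hσ : ∀ σ, ∑ i ∈ range s, (J σ i).card + (s + 1) * (J σ s).card ≤ s * (2 * s + 1) := by
    intro σ
    have hmono : ∀ i j, i ≤ j → j ≤ s → J σ j ⊆ J σ i := fun i j hij hj x hx => by
      simp only [hJ, mem_filter, mem_univ, true_and] at hx ⊢
      exact hnest i j hij hj hx
    obtain ⟨i, his, hi⟩ := exists_card_le_of_no_representatives (J σ) (by
      rintro ⟨f, hf, hfJ⟩
      refine hcross ⟨fun i => (D (f i)).image σ, fun i => ?_, fun i j hij => ?_⟩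
      · have := hfJ i
        simp only [hJ, mem_filter, mem_univ, true_and] at this
        exact this
      · exact (disjoint_image (Equiv.injective _)).2 (hDd _ _ fun h => hij (hf h)))
    have h1 : ∑ m ∈ range i, (J σ m).card ≤ i * (2 * s + 1) := by
      have := sum_le_card_nsmul (range i) (fun m => (J σ m).card) _ fun m _ => hJle σ m
      simpa using this
    have h2 : ∑ m ∈ Ico i s, (J σ m).card ≤ (s - i) * (s - i) := by
      have := sum_le_card_nsmul (Ico i s) (fun m => (J σ m).card) (s - i) fun m hm =>
        (card_le_card (hmono i m (mem_Ico.1 hm).1 (mem_Ico.1 hm).2.le)).trans hi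
      simpa using this
    have h3 : (J σ s).card ≤ s - i := (card_le_card (hmono i s his le_rfl)).trans hi
    rw [← sum_range_add_sum_Ico _ his]
    obtain ⟨d, rfl⟩ := Nat.exists_eq_add_of_le his
    rw [Nat.add_sub_cancel_left] at h2 h3
    have h4 : (i + d + 1) * (J σ (i + d)).card ≤ (i + d + 1) * d := Nat.mul_le_mul_left _ h3
    nlinarith
  have hsum : ∀ i, (∑ σ, (J σ i).card) * (Fintype.card α).choose l
      = (2 * s + 1) * (𝒢 i).card * Fintype.card (Equiv.Perm α) := by
    intro i
    have hswap : ∑ σ, (J σ i).card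
        = ∑ j, (univ.filter fun σ : Equiv.Perm α => (D j).image σ ∈ 𝒢 i).card := by
      simp only [hJ, card_filter]
      exact sum_comm
    rw [hswap, sum_mul, sum_congr rfl fun j _ => card_perm_image_mem_mul_choose (hDc j) (h𝒢 i)]
    simp
    ring
  have htot := sum_le_sum fun σ (_ : σ ∈ (univ : Finset (Equiv.Perm α))) => hσ σ
  rw [sum_add_distrib, ← mul_sum, sum_comm, sum_const, card_univ, smul_eq_mul] at htot
  have hmul := Nat.mul_le_mul_right ((Fintype.card α).choose l) htot
  rw [add_mul, sum_mul, mul_assoc (s + 1), hsum, sum_congr rfl fun i _ => hsum i, ← sum_mul,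
    ← mul_sum] at hmul
  have hpos : 0 < (2 * s + 1) * Fintype.card (Equiv.Perm α) :=
    Nat.mul_pos (by omega) Fintype.card_pos
  refine Nat.le_of_mul_le_mul_left (le_trans (le_of_eq ?_) (hmul.trans (le_of_eq ?_))) hpos <;> ring

end CrossDependent

/-! ### The cover bound on many vertices -/

/-- The edges meeting the initial segment `[s + 1]` in at most one vertex, sorted by their trace. -/
lemma card_filter_inter_le_one (s : ℕ) (F : Finset (Finset ℕ)) :
    (F.filter fun E => (E ∩ Icc 1 (s + 1)).card ≤ 1).card
      = (F.filter fun E => E ∩ Icc 1 (s + 1) = ∅).card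
        + ∑ i ∈ range (s + 1), (F.filter fun E => E ∩ Icc 1 (s + 1) = {i + 1}).card := by
  have h : (F.filter fun E => (E ∩ Icc 1 (s + 1)).card ≤ 1)
      = (F.filter fun E => E ∩ Icc 1 (s + 1) = ∅) ∪
        (range (s + 1)).biUnion fun i => F.filter fun E => E ∩ Icc 1 (s + 1) = {i + 1} := by
    ext E
    simp only [mem_filter, mem_union, mem_biUnion, mem_range]
    constructor
    · rintro ⟨hE, h⟩
      rcases Nat.le_one_iff_eq_zero_or_eq_one.1 h with h | h
      · exact Or.inl ⟨hE, card_eq_zero.1 h⟩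
      · obtain ⟨x, hx⟩ := card_eq_one.1 h
        have hxm : x ∈ E ∩ Icc 1 (s + 1) := by rw [hx]; exact mem_singleton_self x
        have := mem_Icc.1 (mem_inter.1 hxm).2
        refine Or.inr ⟨x - 1, by omega, hE, ?_⟩
        rw [hx, Nat.sub_add_cancel this.1]
    · rintro (⟨hE, h⟩ | ⟨i, -, hE, h⟩) <;> exact ⟨hE, by rw [h]; simp⟩
  rw [h, card_union_of_disjoint, card_biUnion]
  · intro i _ j _ hij
    refine disjoint_left.2 fun E hE hE' => hij ?_
    have h1 := (mem_filter.1 hE).2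
    rw [(mem_filter.1 hE').2, singleton_inj] at h1
    omega
  · refine disjoint_left.2 fun E hE hE' => ?_
    obtain ⟨i, -, hi⟩ := mem_biUnion.1 hE'
    have h1 := (mem_filter.1 hE).2
    rw [(mem_filter.1 hi).2] at h1
    exact singleton_ne_empty _ h1

/-- The embedding of `Fin N` onto the interval of length `N` that starts at `a`. -/
def shiftEmb (a N : ℕ) : Fin N ↪ ℕ where
  toFun j := a + j
  inj' i j h := Fin.ext (by simpa using h)

lemma shiftEmb_apply (a N : ℕ) (j : Fin N) : shiftEmb a N j = a + j := rfl

/-- The link of `i + 1` in the subfamily of edges meeting `[s + 1]` in `{i + 1}`, with the remaining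
`N` vertices relabelled by `Fin N`. -/
def tailLink (s r N : ℕ) (F : Finset (Finset ℕ)) (i : ℕ) : Finset (Finset (Fin N)) :=
  (powersetCard (r - 1) univ).filter fun B => insert (i + 1) (B.map (shiftEmb (s + 2) N)) ∈ F

lemma map_shiftEmb_subset {s N : ℕ} (B : Finset (Fin N)) :
    B.map (shiftEmb (s + 2) N) ⊆ Icc (s + 2) (N + s + 1) := by
  intro x hx
  obtain ⟨j, -, rfl⟩ := mem_map.1 hx
  have := j.2
  simp only [shiftEmb_apply, mem_Icc]
  omega

lemma card_tailLink {s r N i : ℕ} (hi : i < s + 1) {F : Finset (Finset ℕ)}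
    (hF : F ⊆ allEdges r (N + s + 1)) :
    (F.filter fun E => E ∩ Icc 1 (s + 1) = {i + 1}).card = (tailLink s r N F i).card := by
  have hnot : ∀ (B : Finset (Fin N)) x, x ≤ s + 1 → x ∉ B.map (shiftEmb (s + 2) N) :=
    fun B x hx h => by
      have := mem_Icc.1 (map_shiftEmb_subset B h)
      omega
  refine (card_bij (fun B _ => insert (i + 1) (B.map (shiftEmb (s + 2) N))) (fun B hB => ?_)
    (fun A _ B _ hAB => ?_) fun E hE => ?_).symm
  · refine mem_filter.2 ⟨(mem_filter.1 hB).2, ?_⟩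
    ext x
    simp only [mem_inter, mem_insert, mem_Icc, mem_singleton]
    constructor
    · rintro ⟨rfl | h, h2⟩
      · rfl
      · exact absurd h (hnot B x h2.2)
    · rintro rfl
      exact ⟨Or.inl rfl, by omega, by omega⟩
  · have h := congrArg (fun D => erase D (i + 1)) hAB
    simp only [erase_insert (hnot _ (i + 1) (by omega))] at h
    exact map_injective _ h
  · obtain ⟨hEF, hE⟩ := mem_filter.1 hE
    obtain ⟨hE1, hE2⟩ := mem_allEdges.1 (hF hEF)
    have hiE : i + 1 ∈ E := by
      have : i + 1 ∈ E ∩ Icc 1 (s + 1) := by rw [hE]; exact mem_singleton_self _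
      exact (mem_inter.1 this).1
    have hmap : (univ.filter fun j : Fin N => s + 2 + (j : ℕ) ∈ E).map (shiftEmb (s + 2) N)
        = E.erase (i + 1) := by
      ext x
      simp only [mem_map, mem_filter, mem_univ, true_and, shiftEmb_apply,
        mem_erase]
      constructor
      · rintro ⟨j, hj, rfl⟩
        exact ⟨by omega, hj⟩
      · rintro ⟨hx, hxE⟩
        have h1 := mem_Icc.1 (hE1 hxE)
        have h2 : s + 1 < x := by
          by_contra hcon
          have : x ∈ E ∩ Icc 1 (s + 1) := mem_inter.2 ⟨hxE, mem_Icc.2 (by omega)⟩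
          rw [hE, mem_singleton] at this
          exact hx this
        exact ⟨⟨x - (s + 2), by omega⟩, by simpa [Nat.add_sub_cancel' h2] using hxE,
          Nat.add_sub_cancel' h2⟩
    refine ⟨univ.filter fun j : Fin N => s + 2 + (j : ℕ) ∈ E, mem_filter.2 ⟨?_, ?_⟩, ?_⟩
    · rw [mem_powersetCard]
      refine ⟨subset_univ _, ?_⟩
      rw [← card_map (shiftEmb (s + 2) N), hmap, card_erase_of_mem hiE, hE2]
    · rw [hmap, insert_erase hiE]
      exact hEF
    · rw [hmap, insert_erase hiE]

/-- The cover bound for stable families on at least `(2s + 1) r - s` vertices. Only the edges meeting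
`[s + 1]` in at most one vertex matter: those missing `[s + 1]` are controlled by their shadow, the
others form nested cross-dependent families. -/
lemma IsStable.card_le_coverTerm {r n s : ℕ} (hr : 1 ≤ r) (hn : (2 * s + 1) * r ≤ n + s)
    {F : Finset (Finset ℕ)} (hF : IsStable r n F) (hs : matchingNumber F ≤ s) :
    F.card ≤ coverTerm r n s := by
  classical
  obtain ⟨l, rfl⟩ := Nat.exists_eq_add_of_le' hr
  obtain ⟨N, rfl⟩ : ∃ N, n = N + s + 1 := ⟨n - s - 1, by
    rw [mul_add] at hn
    omega⟩
  have hN : (2 * s + 1) * l ≤ N := by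
    rw [mul_add] at hn
    omega
  have hsh := hF.shiftClosed
  have hall : ∀ i, tailLink s (l + 1) N (allEdges (l + 1) (N + s + 1)) i ⊆ powersetCard l univ :=
    fun i => filter_subset _ _
  have hcr := sum_card_le_of_crossDependent (s := s) (l := l) (by simpa using hN)
    (tailLink s (l + 1) N F) (fun i => filter_subset _ _)
    (fun i j hij hj B hB => by
      rcases hij.eq_or_lt with rfl | hlt
      · exact hB
      obtain ⟨h1, h2⟩ := mem_filter.1 hB
      refine mem_filter.2 ⟨h1, ?_⟩
      have hnot : ∀ x, x ≤ s + 1 → x ∉ B.map (shiftEmb (s + 2) N) := fun x hx h => by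
        have := mem_Icc.1 (map_shiftEmb_subset B h)
        omega
      have := hsh _ h2 (j + 1) (mem_insert_self _ _) (i + 1) (by omega) (by omega) (by
        rw [mem_insert, not_or]
        exact ⟨by omega, hnot _ (by omega)⟩)
      rwa [erase_insert (hnot _ (by omega))] at this)
    (by
      rintro ⟨D, hD, hdisj⟩
      obtain ⟨hM, hMc⟩ := isMatching_image (F := F) (M := (univ : Finset (Fin (s + 1))))
        (fun i => insert ((i : ℕ) + 1) ((D i).map (shiftEmb (s + 2) N)))
        (fun i _ => (mem_filter.1 (hD i)).2) (fun i _ => insert_nonempty _ _)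
        (fun i _ j _ hij => by
          have hnot : ∀ (B : Finset (Fin N)) (i : Fin (s + 1)),
              (i : ℕ) + 1 ∉ B.map (shiftEmb (s + 2) N) := fun B i h => by
            have := mem_Icc.1 (map_shiftEmb_subset B h)
            omega
          rw [disjoint_insert_left, disjoint_insert_right, mem_insert, not_or]
          refine ⟨⟨fun h => hij (Fin.ext (by omega)), hnot _ _⟩, hnot _ _, ?_⟩
          exact (disjoint_map _).2 (hdisj i j hij))
      have := hM.card_le
      rw [hMc, card_univ, Fintype.card_fin] at this
      omega)
  rw [Fintype.card_fin] at hcr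
  -- the edges that miss `[s + 1]`
  have hzero : (F.filter fun E => E ∩ Icc 1 (s + 1) = ∅).card
      ≤ s * (tailLink s (l + 1) N F s).card := by
    set A := F.filter fun E => E ∩ Icc 1 (s + 1) = ∅ with hA
    have hAsub : A ⊆ powersetCard (l + 1) (Icc (s + 2) (N + s + 1)) := by
      intro E hE
      obtain ⟨h1, h2⟩ := mem_filter.1 hE
      obtain ⟨h3, h4⟩ := mem_allEdges.1 (hF.1 h1)
      refine mem_powersetCard.2 ⟨fun x hx => ?_, h4⟩
      have := mem_Icc.1 (h3 hx)
      have : x ∉ Icc 1 (s + 1) := fun hx' => by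
        have : x ∈ E ∩ Icc 1 (s + 1) := mem_inter.2 ⟨hx, hx'⟩
        rw [h2] at this
        exact notMem_empty _ this
      rw [mem_Icc] at this ⊢
      omega
    have hlow : ∀ E ∈ A, ∀ x ∈ E, s + 2 ≤ x := fun E hE x hx =>
      (mem_Icc.1 ((mem_powersetCard.1 (hAsub hE)).1 hx)).1
    have hAsh : ShiftClosed (s + 2) A := by
      intro E hE j hj i hi hij hiE
      refine mem_filter.2 ⟨hsh E (mem_filter.1 hE).1 j hj i (by omega) hij hiE, ?_⟩
      rw [← disjoint_iff_inter_eq_empty, disjoint_left]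
      intro x hx hx'
      have := mem_Icc.1 hx'
      rcases mem_insert.1 hx with rfl | hx
      · omega
      · have := hlow E hE x (mem_of_mem_erase hx)
        omega
    refine (card_le_mul_card_shadow (by omega) hAsub hAsh
      ((matchingNumber_mono (filter_subset _ _)).trans hs)).trans (Nat.mul_le_mul_left _ ?_)
    rw [← card_tailLink (by omega) hF.1]
    have hDlow : ∀ D ∈ ∂ A, ∀ x ∈ D, s + 2 ≤ x := fun D hD x hx => by
      obtain ⟨E, hE, hDE⟩ := exists_subset_of_mem_shadow hD
      exact hlow E hE x (hDE hx)
    have hs1 : ∀ D ∈ ∂ A, s + 1 ∉ D := fun D hD h => by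
      have := hDlow D hD _ h
      omega
    refine card_le_card_of_injOn (fun D => insert (s + 1) D) (fun D hD => ?_) ?_
    · refine mem_coe.2 (mem_filter.2 ⟨?_, ?_⟩)
      · obtain ⟨E, hE, x, hx, rfl⟩ := mem_shadow_iff.1 hD
        have h1 := hlow E hE x hx
        refine hsh E (mem_filter.1 hE).1 x hx (s + 1) (by omega) (by omega) fun h => ?_
        have := hlow E hE _ h
        omega
      · ext x
        simp only [mem_inter, mem_insert, mem_Icc, mem_singleton]
        constructor
        · rintro ⟨rfl | h, h2⟩
          · rfl
          · have := hDlow D hD x h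
            omega
        · rintro rfl
          exact ⟨Or.inl rfl, by omega, by omega⟩
    · intro C hC D hD hCD
      rw [← erase_insert (hs1 C hC), ← erase_insert (hs1 D hD)]
      exact congrArg (fun D => erase D (s + 1)) hCD
  -- the corresponding counts for all `r`-sets
  have hallcard : ∀ i ∈ range (s + 1), ((allEdges (l + 1) (N + s + 1)).filter
      fun E => E ∩ Icc 1 (s + 1) = {i + 1}).card = N.choose l := by
    intro i hi
    rw [mem_range] at hi
    rw [card_tailLink hi Subset.rfl, tailLink, filter_true_of_mem, card_powersetCard,
      card_univ, Fintype.card_fin, Nat.add_sub_cancel]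
    intro B hB
    rw [mem_powersetCard, Nat.add_sub_cancel] at hB
    refine mem_allEdges.2 ⟨insert_subset (mem_Icc.2 (by omega))
      ((map_shiftEmb_subset B).trans (Icc_subset_Icc_left (by omega))), ?_⟩
    rw [card_insert_of_notMem, card_map, hB.2]
    intro h
    have := mem_Icc.1 (map_shiftEmb_subset B h)
    omega
  have hallzero : ((allEdges (l + 1) (N + s + 1)).filter
      fun E => E ∩ Icc 1 (s + 1) = ∅).card = N.choose (l + 1) := by
    have : (allEdges (l + 1) (N + s + 1)).filter (fun E => E ∩ Icc 1 (s + 1) = ∅)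
        = powersetCard (l + 1) (Icc (s + 2) (N + s + 1)) := by
      ext E
      rw [mem_filter, mem_allEdges, mem_powersetCard, ← disjoint_iff_inter_eq_empty]
      constructor
      · rintro ⟨⟨h1, h2⟩, h3⟩
        refine ⟨fun x hx => ?_, h2⟩
        have hx1 := mem_Icc.1 (h1 hx)
        have hx2 := disjoint_left.1 h3 hx
        rw [mem_Icc] at hx2 ⊢
        omega
      · rintro ⟨h1, h2⟩
        refine ⟨⟨h1.trans (Icc_subset_Icc_left (by omega)), h2⟩,
          disjoint_left.2 fun x hx hx' => ?_⟩
        have := mem_Icc.1 (h1 hx)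
        have := mem_Icc.1 hx'
        omega
    rw [this, card_powersetCard, Nat.card_Icc]
    congr 1
    omega
  have hFsplit := card_filter_inter_le_one s F
  have hAsplit := card_filter_inter_le_one s (allEdges (l + 1) (N + s + 1))
  rw [hallzero, sum_congr rfl hallcard, sum_const, card_range, smul_eq_mul] at hAsplit
  rw [sum_congr rfl fun i hi => card_tailLink (mem_range.1 hi) hF.1,
    sum_range_succ] at hFsplit
  have h1 := card_filter_add_card_filter_not (s := F)
    (fun E => (E ∩ Icc 1 (s + 1)).card ≤ 1)
  have h2 := card_filter_add_card_filter_not (s := allEdges (l + 1) (N + s + 1))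
    (fun E => (E ∩ Icc 1 (s + 1)).card ≤ 1)
  have h3 := card_le_card (filter_subset_filter
    (fun E => ¬ (E ∩ Icc 1 (s + 1)).card ≤ 1) hF.1)
  rw [card_allEdges] at h2
  rw [le_coverTerm_iff, show N + s + 1 - s = N + 1 by omega, Nat.choose_succ_succ']
  rw [add_mul, one_mul] at hcr hAsplit
  omega

/-- `m_r(n, s)` is at most the cover term for `n ≥ (2s + 1) r - s`. -/
lemma maxEdges_le_coverTerm {r n s : ℕ} (hr : 1 ≤ r) (hn : (2 * s + 1) * r ≤ n + s)
    (hn' : r * (s + 1) ≤ n) : maxEdges r n s ≤ coverTerm r n s := by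
  obtain ⟨G, hG, hGs, -, hGc⟩ := exists_stable_maximal_card_eq hr hn'
  rw [← hGc]
  exact hG.card_le_coverTerm hr hn hGs.le

/-! ### Averaging the local functional over the boards -/

lemma IsCompressedMatching.card_edge {r n s : ℕ} {F M : Finset (Finset ℕ)}
    (hM : IsCompressedMatching r s F M) (hF : F ⊆ allEdges r n) {E : Finset ℕ} (hE : E ∈ M) :
    E.card = r :=
  (mem_allEdges.1 (hF (hM.1.1 hE))).2

lemma IsCompressedMatching.card_residual {r n s : ℕ} {F M : Finset (Finset ℕ)}
    (hM : IsCompressedMatching r s F M) (hF : F ⊆ allEdges r n) :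
    (residual r s M).card = r - 1 := by
  have hc := card_biUnion_of_isMatching hM.1 fun E hE => hM.card_edge hF hE
  have hsub : M.biUnion id ⊆ core r s := biUnion_subset.2 fun E hE => (hM.2.2 E hE).2
  rw [residual, card_sdiff_of_subset hsub, hc, hM.2.1,
    core, Nat.card_Icc, mul_comm s r]
  omega

/-- Every edge meets the core in at least two vertices. Otherwise stability yields the edge made of
the residual set and the first vertex outside the core, which enlarges the selected matching. -/
lemma two_le_card_inter_core {r n s : ℕ} (hr : 2 ≤ r) {F M : Finset (Finset ℕ)}
    (hF : IsStable r n F) (hs : matchingNumber F = s) (hM : IsCompressedMatching r s F M)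
    {E : Finset ℕ} (hE : E ∈ F) : 2 ≤ (E ∩ core r s).card := by
  classical
  by_contra hcon
  obtain ⟨hE1, hE2⟩ := mem_allEdges.1 (hF.1 hE)
  have hcore : ∀ x, x ∈ core r s ↔ 1 ≤ x ∧ x < r * s + r := fun x => by
    rw [core, mem_Icc]; omega
  have hn : r * s + r ≤ n := by
    have : ¬ E ⊆ core r s := fun h => by
      rw [inter_eq_left.2 h] at hcon
      omega
    obtain ⟨x, hx, hxK⟩ := not_subset.1 this
    have := mem_Icc.1 (hE1 hx)
    rw [hcore] at hxK
    omega
  set R := residual r s M with hR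
  have hRK : ∀ x ∈ R, 1 ≤ x ∧ x < r * s + r := fun x hx => (hcore x).1 (mem_sdiff.1 hx).1
  have hRM : ∀ x ∈ R, ∀ D ∈ M, x ∉ D := fun x hx D hD hxD =>
    (mem_sdiff.1 hx).2 (mem_biUnion.2 ⟨D, hD, hxD⟩)
  have h1R : 1 ∈ R := mem_sdiff.2 ⟨(hcore 1).2 ⟨le_rfl, by omega⟩, fun h => by
    obtain ⟨D, hD, h1D⟩ := mem_biUnion.1 h
    exact (hM.2.2 D hD).1 h1D⟩
  have hwR : r * s + r ∉ R := fun h => by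
    have := hRK _ h
    omega
  have hAc : (insert (r * s + r) R).card = r := by
    rw [card_insert_of_notMem hwR, hM.card_residual hF.1]
    omega
  have hAF : insert (r * s + r) R ∈ F := by
    refine hF.2 E hE _ (mem_allEdges.2 ⟨insert_subset (mem_Icc.2 ⟨by omega, hn⟩) fun x hx => ?_,
      hAc⟩) (coordLE_iff.2 ⟨hAc, hE2, fun k => ?_⟩)
    · have := hRK x hx
      exact mem_Icc.2 ⟨by omega, by omega⟩
    by_cases hk : r * s + r ≤ k
    · rw [filter_true_of_mem (s := insert (r * s + r) R), hAc, ← hE2]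
      · exact card_filter_le _ _
      · intro x hx
        rcases mem_insert.1 hx with rfl | hx
        · exact hk
        · have := hRK x hx
          omega
    · have hsub : E.filter (· ≤ k) ⊆ E ∩ core r s := fun x hx => by
        rw [mem_filter] at hx
        have := mem_Icc.1 (hE1 hx.1)
        exact mem_inter.2 ⟨hx.1, (hcore x).2 (by omega)⟩
      have hle := card_le_card hsub
      rcases (E.filter (· ≤ k)).eq_empty_or_nonempty with h | ⟨x, hx⟩
      · rw [h]; simp
      · rw [mem_filter] at hx
        have := mem_Icc.1 (hE1 hx.1)
        have hpos : 0 < ((insert (r * s + r) R).filter (· ≤ k)).card :=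
          card_pos.2 ⟨1, mem_filter.2 ⟨mem_insert_of_mem h1R, by omega⟩⟩
        omega
  have hdisj : ∀ D ∈ M, Disjoint (insert (r * s + r) R) D := by
    intro D hD
    refine disjoint_left.2 fun x hx hxD => ?_
    rcases mem_insert.1 hx with rfl | hx
    · have := (hcore _).1 ((hM.2.2 D hD).2 hxD)
      omega
    · exact hRM x hx D hD hxD
  have hnotM : insert (r * s + r) R ∉ M := fun h =>
    disjoint_left.1 (hdisj _ h) (mem_insert_self _ _) (mem_insert_self _ _)
  have hbig : IsMatching F (insert (insert (r * s + r) R) M) := by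
    refine ⟨insert_subset hAF hM.1.1, fun A hA B hB hAB => ?_⟩
    rcases mem_insert.1 hA with rfl | hA <;> rcases mem_insert.1 hB with rfl | hB
    · exact absurd rfl hAB
    · exact hdisj B hB
    · exact (hdisj A hA).symm
    · exact hM.1.2 A hA B hB hAB
  have := hbig.card_le
  rw [card_insert_of_notMem hnotM, hM.2.1] at this
  omega

/-- The edges of the matching `M` that meet `H`. -/
def columnsMet (M : Finset (Finset ℕ)) (H : Finset ℕ) : Finset (Finset ℕ) :=
  M.filter fun E => ¬ Disjoint H E

lemma columnsMet_subset (M : Finset (Finset ℕ)) (H : Finset ℕ) : columnsMet M H ⊆ M :=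
  filter_subset _ _

lemma card_columnsMet_le {F M : Finset (Finset ℕ)} (hM : IsMatching F M) (H : Finset ℕ) :
    (columnsMet M H).card ≤ H.card := by
  have hex : ∀ E ∈ columnsMet M H, ∃ x, x ∈ H ∧ x ∈ E := fun E hE =>
    not_disjoint_iff.1 (mem_filter.1 hE).2
  choose! f hfH hfE using hex
  refine card_le_card_of_injOn f hfH fun A hA B hB hAB => ?_
  by_contra hne
  exact disjoint_left.1 (hM.2 A (mem_filter.1 hA).1 B (mem_filter.1 hB).1 hne) (hfE A hA)
    (hAB ▸ hfE B hB)

lemma subset_localBoard_iff {r s : ℕ} {F M τ : Finset (Finset ℕ)} (hM : IsMatching F M)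
    (hτ : τ ⊆ M) {H : Finset ℕ} (hH : H ⊆ core r s) :
    H ⊆ localBoard r s M τ ↔ columnsMet M H ⊆ τ := by
  constructor
  · intro h E hE
    obtain ⟨hEM, hd⟩ := mem_filter.1 hE
    obtain ⟨x, hxH, hxE⟩ := not_disjoint_iff.1 hd
    rcases mem_union.1 (h hxH) with hx | hx
    · exact absurd (mem_biUnion.2 ⟨E, hEM, hxE⟩) (mem_sdiff.1 hx).2
    · obtain ⟨D, hD, hxD⟩ := mem_biUnion.1 hx
      by_contra hEτ
      exact disjoint_left.1 (hM.2 E hEM D (hτ hD) fun h => hEτ (h ▸ hD)) hxE hxD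
  · intro h x hx
    by_cases hxM : x ∈ M.biUnion id
    · obtain ⟨E, hE, hxE⟩ := mem_biUnion.1 hxM
      exact mem_union_right _ (mem_biUnion.2 ⟨E, h (mem_filter.2 ⟨hE,
        not_disjoint_iff.2 ⟨x, hx, hxE⟩⟩), hxE⟩)
    · exact mem_union_left _ (mem_sdiff.2 ⟨hH hx, hxM⟩)

lemma localBoard_subset_core {r s : ℕ} {F M τ : Finset (Finset ℕ)}
    (hM : IsCompressedMatching r s F M) (hτ : τ ⊆ M) : localBoard r s M τ ⊆ core r s :=
  union_subset sdiff_subset (biUnion_subset.2 fun E hE => (hM.2.2 E (hτ hE)).2)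

/-- Each set `H` lies in exactly `(s - z).choose (r - z)` boards, `z` being the number of matching
edges met by `H`; so the weights `1 / (s - z).choose (r - z)` sum to `1` over these boards. -/
lemma sum_sum_localBoard {r s : ℕ} (hrs : r ≤ s) {F M : Finset (Finset ℕ)}
    (hM : IsMatching F M) (hMs : M.card = s) (𝒜 : Finset (Finset ℕ))
    (h𝒜 : ∀ H ∈ 𝒜, H ⊆ core r s ∧ H.card ≤ r) (f : Finset ℕ → ℚ) :
    ∑ τ ∈ M.powersetCard r, ∑ H ∈ 𝒜.filter (· ⊆ localBoard r s M τ),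
        f H / ((s - (columnsMet M H).card).choose (r - (columnsMet M H).card) : ℚ)
      = ∑ H ∈ 𝒜, f H := by
  simp only [sum_filter]
  rw [sum_comm]
  refine sum_congr rfl fun H hH => ?_
  obtain ⟨hHK, hHr⟩ := h𝒜 H hH
  have hz := (card_columnsMet_le hM H).trans hHr
  rw [← sum_filter, sum_const, filter_congr fun τ hτ =>
    subset_localBoard_iff hM (mem_powersetCard.1 hτ).1 hHK,
    card_filter_powersetCard_subset _ _ _ (columnsMet_subset M H) hz, hMs, nsmul_eq_mul]
  refine mul_div_cancel₀ _ ?_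
  exact_mod_cast (Nat.choose_pos (Nat.sub_le_sub_right hrs _)).ne'

lemma card_board (r : ℕ) : Fintype.card (Board r) = r - 1 + r * r := by simp

/-- A local board is identified with the abstract board, residual part to residual part and matching
edges to columns. -/
lemma exists_board_bijection {r n s : ℕ} (hr : 1 ≤ r) {F M τ : Finset (Finset ℕ)}
    (hF : F ⊆ allEdges r n) (hM : IsCompressedMatching r s F M) (hτ : τ ⊆ M) (hτr : τ.card = r) :
    ∃ φ : ℕ → Board r, Set.BijOn φ (localBoard r s M τ) Set.univ ∧
      (residual r s M).image φ = boardResidual r ∧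
      ∃ σ : τ ≃ Fin r, ∀ E : τ, (E : Finset ℕ).image φ = boardColumn r (σ E) := by
  classical
  have hRc := hM.card_residual hF
  set R := residual r s M with hR
  let eR := R.equivFinOfCardEq hRc
  let σ := τ.equivFinOfCardEq hτr
  let e : ∀ E : τ, (E : Finset ℕ) ≃ Fin r := fun E =>
    (E : Finset ℕ).equivFinOfCardEq (hM.card_edge hF (hτ E.2))
  let φ : ℕ → Board r := fun x =>
    if h : x ∈ R then Sum.inl (eR ⟨x, h⟩)
    else if h : ∃ E : τ, x ∈ (E : Finset ℕ) then
      Sum.inr (σ h.choose, e h.choose ⟨x, h.choose_spec⟩)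
    else Sum.inr (⟨0, hr⟩, ⟨0, hr⟩)
  have hφR : ∀ x (h : x ∈ R), φ x = Sum.inl (eR ⟨x, h⟩) := fun x h => dif_pos h
  have hφE : ∀ (E : τ) x (h : x ∈ (E : Finset ℕ)), φ x = Sum.inr (σ E, e E ⟨x, h⟩) := by
    intro E x h
    have hxR : x ∉ R := fun hx => (mem_sdiff.1 hx).2 (mem_biUnion.2 ⟨E, hτ E.2, h⟩)
    have hex : ∃ E : τ, x ∈ (E : Finset ℕ) := ⟨E, h⟩
    have hch : hex.choose = E := by
      by_contra hne
      exact disjoint_left.1 (hM.1.2 _ (hτ hex.choose.2) _ (hτ E.2)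
        fun h => hne (Subtype.ext h)) hex.choose_spec h
    have h1 : φ x = Sum.inr (σ hex.choose, e hex.choose ⟨x, hex.choose_spec⟩) := by
      simp only [φ]
      rw [dif_neg hxR, dif_pos hex]
    rw [h1]
    have h2 : ∀ (D : τ) (hD : x ∈ (D : Finset ℕ)), D = E →
        (Sum.inr (σ D, e D ⟨x, hD⟩) : Board r) = Sum.inr (σ E, e E ⟨x, h⟩) := by
      rintro D hD rfl
      rfl
    exact h2 _ _ hch
  have himR : R.image φ = boardResidual r := by
    ext b
    simp only [boardResidual, mem_image, mem_univ, true_and]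
    constructor
    · rintro ⟨x, hx, rfl⟩
      exact ⟨_, (hφR x hx).symm⟩
    · rintro ⟨j, rfl⟩
      refine ⟨eR.symm j, (eR.symm j).2, ?_⟩
      rw [hφR _ (eR.symm j).2]
      simp
  have himE : ∀ E : τ, (E : Finset ℕ).image φ = boardColumn r (σ E) := by
    intro E
    ext b
    simp only [boardColumn, mem_image, mem_univ, true_and]
    constructor
    · rintro ⟨x, hx, rfl⟩
      exact ⟨_, (hφE E x hx).symm⟩
    · rintro ⟨j, rfl⟩
      refine ⟨(e E).symm j, ((e E).symm j).2, ?_⟩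
      rw [hφE E _ ((e E).symm j).2]
      simp
  have himV : (localBoard r s M τ).image φ = univ := by
    refine eq_univ_of_forall fun b => ?_
    rcases b with j | ⟨i, j⟩
    · have : Sum.inl j ∈ R.image φ := by rw [himR]; simp [boardResidual]
      exact image_subset_image subset_union_left this
    · have : Sum.inr (i, j) ∈ ((σ.symm i : τ) : Finset ℕ).image φ := by
        rw [himE]; simp [boardColumn]
      exact image_subset_image ((subset_biUnion_of_mem id (σ.symm i).2).trans
        subset_union_right) this
  have hVc : (localBoard r s M τ).card ≤ r - 1 + r * r := by
    refine (card_union_le _ _).trans (Nat.add_le_add hRc.le ?_)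
    rw [card_biUnion_of_isMatching (hM.1.subset hτ) fun E hE => hM.card_edge hF (hτ hE), hτr]
  refine ⟨φ, ⟨fun _ _ => Set.mem_univ _, ?_, ?_⟩, himR, σ, himE⟩
  · refine card_image_iff.1 (le_antisymm card_image_le ?_)
    rw [himV, card_univ, card_board]
    exact hVc
  · rw [Set.SurjOn, ← coe_image, himV, coe_univ]

lemma image_injOn_subsets {α β : Type*} [DecidableEq β] {V : Finset α} {φ : α → β}
    (hφ : Set.InjOn φ V) {A B : Finset α} (hA : A ⊆ V) (hB : B ⊆ V)
    (h : A.image φ = B.image φ) : A = B := by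
  have key : ∀ C D : Finset α, C ⊆ V → D ⊆ V → C.image φ = D.image φ → C ⊆ D := by
    intro C D hC hD hCD x hx
    have : φ x ∈ D.image φ := hCD ▸ mem_image_of_mem φ hx
    obtain ⟨y, hy, hyx⟩ := mem_image.1 this
    rwa [← hφ (hD hy) (hC hx) hyx]
  exact Subset.antisymm (key A B hA hB h) (key B A hB hA h.symm)

/-- The spread of a subset of a board is the number of edges of the whole matching that it meets. -/
lemma spread_image {r s : ℕ} {F M τ : Finset (Finset ℕ)} (hM : IsCompressedMatching r s F M)
    (hτ : τ ⊆ M) {φ : ℕ → Board r} (hφ : Set.InjOn φ (localBoard r s M τ)) (σ : τ ≃ Fin r)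
    (hσ : ∀ E : τ, (E : Finset ℕ).image φ = boardColumn r (σ E)) {H : Finset ℕ}
    (hH : H ⊆ localBoard r s M τ) : spread (H.image φ) = (columnsMet M H).card := by
  have hsub := (subset_localBoard_iff hM.1 hτ (hH.trans (localBoard_subset_core hM hτ))).1 hH
  have hiff : ∀ E : τ, (H.image φ ∩ boardColumn r (σ E)).Nonempty ↔ ¬ Disjoint H (E : Finset ℕ) := by
    intro E
    rw [← hσ E, ← image_inter_of_injOn, image_nonempty, not_disjoint_iff_nonempty_inter]
    refine hφ.mono ?_
    rw [← coe_union]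
    exact coe_subset.2 (union_subset hH ((subset_biUnion_of_mem id E.2).trans subset_union_right))
  refine (card_bij (fun E hE => σ ⟨E, hsub hE⟩) (fun E hE => ?_) (fun A hA B hB hAB => ?_)
    fun i hi => ?_).symm
  · exact mem_filter.2 ⟨mem_univ _, (hiff ⟨E, hsub hE⟩).2 (mem_filter.1 hE).2⟩
  · simpa using σ.injective hAB
  · have hi := (mem_filter.1 hi).2
    obtain ⟨E, rfl⟩ := σ.surjective i
    exact ⟨E, mem_filter.2 ⟨hτ E.2, (hiff E).1 hi⟩, rfl⟩

lemma mem_traces_iff {r n s : ℕ} {F : Finset (Finset ℕ)} (hF : F ⊆ allEdges r n) {T : Finset ℕ}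
    (hTK : T ⊆ core r s) (hTr : T.card = r) : T ∈ traces r s F ↔ T ∈ F := by
  rw [traces, mem_image]
  constructor
  · rintro ⟨E, hE, rfl⟩
    have hEr := (mem_allEdges.1 (hF hE)).2
    rwa [eq_of_subset_of_card_le inter_subset_left (by omega)]
  · exact fun h => ⟨T, h, inter_eq_left.2 hTK⟩

lemma mem_traces_card {r n s : ℕ} {F : Finset (Finset ℕ)} (hF : F ⊆ allEdges r n) {H : Finset ℕ}
    (hH : H ∈ traces r s F) : H ⊆ core r s ∧ H.card ≤ r := by
  obtain ⟨E, hE, rfl⟩ := mem_image.1 hH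
  exact ⟨inter_subset_right, (card_le_card inter_subset_left).trans (mem_allEdges.1 (hF hE)).2.le⟩

/-- Every board gives an actual selected local configuration, and its functional can be computed on
the original vertices. -/
lemma exists_isActual {r s q : ℕ} (hr : 2 ≤ r) (S : SelectionRule r) {F M τ : Finset (Finset ℕ)}
    (hF : IsStableMaximalOne r (r * s + r - 1 + q) s F)
    (hMS : S.select (r * s + r - 1 + q) F = M) (hτ : τ ⊆ M) (hτr : τ.card = r) :
    ∃ L, IsActual S s q L ∧ localFunctional s q L =
      (∑ H ∈ ((traces r s F).filter fun H => H.card < r).filter (· ⊆ localBoard r s M τ),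
        (q.choose (r - H.card) : ℚ) /
          ((s - (columnsMet M H).card).choose (r - (columnsMet M H).card) : ℚ)) -
      ∑ T ∈ (((core r s).powersetCard r).filter (· ∉ F)).filter (· ⊆ localBoard r s M τ),
        (1 : ℚ) / ((s - (columnsMet M T).card).choose (r - (columnsMet M T).card) : ℚ) := by
  classical
  have hM : IsCompressedMatching r s F M := hMS ▸ S.isCompressed _ s F (by omega) hF
  have hFe := hF.1.1
  obtain ⟨φ, hφ, hφR, σ, hσ⟩ := exists_board_bijection (by omega) hFe hM hτ hτr
  have hVK := localBoard_subset_core hM hτ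
  set V := localBoard r s M τ with hV
  have hinj : Set.InjOn φ V := hφ.injOn
  have hcard : ∀ H ⊆ V, (H.image φ).card = H.card := fun H hH =>
    card_image_of_injOn (hinj.mono (coe_subset.2 hH))
  have hspread : ∀ H ⊆ V, spread (H.image φ) = (columnsMet M H).card := fun H hH =>
    spread_image hM hτ hinj σ hσ hH
  have hloc : ∀ H, H ∈ localTraces r s F M τ ↔ H ∈ traces r s F ∧ H ⊆ V := fun H => mem_filter
  have htwo : ∀ H ∈ traces r s F, 2 ≤ H.card := fun H hH => by
    obtain ⟨E, hE, rfl⟩ := mem_image.1 hH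
    exact two_le_card_inter_core hr hF.1 hF.2.1 hM hE
  set L := (localTraces r s F M τ).image (fun H => H.image φ) with hL
  refine ⟨L, ⟨fun X hX => ?_, F, hF, τ, by rwa [hMS], hτr, φ, by rwa [hMS], by rwa [hMS],
    ⟨σ, hσ⟩, by rw [hMS]⟩, ?_⟩
  · obtain ⟨H, hH, rfl⟩ := mem_image.1 hX
    rw [hloc] at hH
    rw [hcard H hH.2]
    exact ⟨htwo H hH.1, (mem_traces_card hFe hH.1).2⟩
  unfold localFunctional
  congr 1
  · have h1 : L.filter (fun H => 2 ≤ H.card ∧ H.card < r)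
        = (((traces r s F).filter fun H => H.card < r).filter (· ⊆ V)).image
          (fun H => H.image φ) := by
      ext X
      simp only [hL, mem_filter, mem_image, hloc]
      constructor
      · rintro ⟨⟨H, hH, rfl⟩, h2⟩
        rw [hcard H hH.2] at h2
        exact ⟨H, ⟨⟨hH.1, h2.2⟩, hH.2⟩, rfl⟩
      · rintro ⟨H, hH, rfl⟩
        rw [hcard H hH.2]
        exact ⟨⟨H, ⟨hH.1.1, hH.2⟩, rfl⟩, htwo H hH.1.1, hH.1.2⟩
    rw [h1, sum_image fun A hA B hB => image_injOn_subsets hinj (mem_filter.1 hA).2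
      (mem_filter.1 hB).2]
    refine sum_congr rfl fun H hH => ?_
    have hHV := (mem_filter.1 hH).2
    rw [hcard H hHV, hspread H hHV]
  · have h2 : ((univ : Finset (Board r)).powersetCard r).filter (fun T => T ∉ L)
        = ((((core r s).powersetCard r).filter (· ∉ F)).filter (· ⊆ V)).image
          (fun H => H.image φ) := by
      ext X
      simp only [mem_filter, mem_image, mem_powersetCard, subset_univ, true_and]
      constructor
      · rintro ⟨hXr, hXL⟩
        have himg : (V.filter fun x => φ x ∈ X).image φ = X := by
          ext b
          simp only [mem_image, mem_filter]
          constructor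
          · rintro ⟨x, hx, rfl⟩
            exact hx.2
          · intro hb
            obtain ⟨x, hx, rfl⟩ := hφ.surjOn (Set.mem_univ b)
            exact ⟨x, ⟨hx, hb⟩, rfl⟩
        have hsub : (V.filter fun x => φ x ∈ X) ⊆ V := filter_subset _ _
        have hTr : (V.filter fun x => φ x ∈ X).card = r := by rw [← hcard _ hsub, himg, hXr]
        refine ⟨_, ⟨⟨⟨hsub.trans hVK, hTr⟩, fun hTF => hXL ?_⟩, hsub⟩, himg⟩
        exact mem_image.2 ⟨_, (hloc _).2 ⟨(mem_traces_iff hFe (hsub.trans hVK) hTr).2 hTF, hsub⟩,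
          himg⟩
      · rintro ⟨T, ⟨⟨⟨hTK, hTr⟩, hTF⟩, hTV⟩, rfl⟩
        refine ⟨by rw [hcard T hTV, hTr], fun hTL => hTF ?_⟩
        obtain ⟨H, hH, hHT⟩ := mem_image.1 hTL
        rw [hloc] at hH
        rw [image_injOn_subsets hinj hH.2 hTV hHT] at hH
        exact (mem_traces_iff hFe hTK hTr).1 hH.1
    rw [h2, sum_image fun A hA B hB => image_injOn_subsets hinj (mem_filter.1 hA).2
      (mem_filter.1 hB).2]
    refine sum_congr rfl fun H hH => ?_
    rw [hspread H (mem_filter.1 hH).2]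

/-- The edges not contained in the core, counted by their traces. -/
lemma card_filter_not_subset_core_le {r s q : ℕ} (hr : 1 ≤ r) {F : Finset (Finset ℕ)}
    (hF : F ⊆ allEdges r (r * s + r - 1 + q)) :
    (F.filter fun E => ¬ E ⊆ core r s).card
      ≤ ∑ H ∈ (traces r s F).filter (fun H => H.card < r), q.choose (r - H.card) := by
  rw [card_eq_sum_card_fiberwise (f := fun E => E ∩ core r s)
    (s := F.filter fun E => ¬ E ⊆ core r s) (t := (traces r s F).filter fun H => H.card < r)]
  · refine sum_le_sum fun H hH => ?_
    have hout : (Icc (r * s + r) (r * s + r - 1 + q)).card = q := by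
      rw [Nat.card_Icc]; omega
    rw [← hout, ← card_powersetCard]
    refine card_le_card_of_injOn (fun E => E \ core r s) (fun E hE => ?_) fun A hA B hB hAB => ?_
    · obtain ⟨hEF, rfl⟩ := mem_filter.1 (mem_coe.1 hE)
      obtain ⟨h1, h2⟩ := mem_allEdges.1 (hF (mem_filter.1 hEF).1)
      refine mem_coe.2 (mem_powersetCard.2 ⟨fun x hx => ?_, ?_⟩)
      · obtain ⟨hxE, hxK⟩ := mem_sdiff.1 hx
        have := mem_Icc.1 (h1 hxE)
        rw [core, mem_Icc] at hxK
        rw [mem_Icc]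
        omega
      · change (E \ core r s).card = _
        have := card_sdiff_add_card_inter E (core r s)
        omega
    · have hA := (mem_filter.1 hA).2
      have hB := (mem_filter.1 hB).2
      rw [← sdiff_union_inter A (core r s), ← sdiff_union_inter B (core r s), hA, hB]
      exact congrArg (· ∪ H) hAB
  · intro E hE
    obtain ⟨hE, hEK⟩ := mem_filter.1 (mem_coe.1 hE)
    refine mem_coe.2 (mem_filter.2 ⟨mem_image_of_mem _ hE, ?_⟩)
    refine lt_of_lt_of_eq (card_lt_card ((ssubset_iff_of_subset inter_subset_left).2 ?_))
      (mem_allEdges.1 (hF hE)).2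
    obtain ⟨x, hx, hxK⟩ := not_subset.1 hEK
    exact ⟨x, hx, fun h => hxK (mem_inter.1 h).2⟩

/-- If the local functional is nonpositive on all actual selected local configurations, then stable
maximal property-ONE families are no larger than the clique. -/
lemma card_le_cliqueTerm {r s q : ℕ} (hr : 2 ≤ r) (hrs : r ≤ s) (S : SelectionRule r)
    {F : Finset (Finset ℕ)} (hF : IsStableMaximalOne r (r * s + r - 1 + q) s F)
    (hΦ : ∀ L, IsActual S s q L → localFunctional s q L ≤ 0) : F.card ≤ cliqueTerm r s := by
  classical
  obtain ⟨M, hMS⟩ : ∃ M, S.select (r * s + r - 1 + q) F = M := ⟨_, rfl⟩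
  have hM : IsCompressedMatching r s F M := hMS ▸ S.isCompressed _ s F (by omega) hF
  have hFe := hF.1.1
  set 𝒜 := (traces r s F).filter fun H => H.card < r with h𝒜
  set 𝒯 := ((core r s).powersetCard r).filter (· ∉ F) with h𝒯
  have hle : ∑ τ ∈ M.powersetCard r,
      ((∑ H ∈ 𝒜.filter (· ⊆ localBoard r s M τ), (q.choose (r - H.card) : ℚ) /
          ((s - (columnsMet M H).card).choose (r - (columnsMet M H).card) : ℚ)) -
        ∑ T ∈ 𝒯.filter (· ⊆ localBoard r s M τ),
          (1 : ℚ) / ((s - (columnsMet M T).card).choose (r - (columnsMet M T).card) : ℚ)) ≤ 0 := by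
    refine sum_nonpos fun τ hτ => ?_
    obtain ⟨hτM, hτr⟩ := mem_powersetCard.1 hτ
    obtain ⟨L, hL, hLΦ⟩ := exists_isActual hr S hF hMS hτM hτr
    rw [← hLΦ]
    exact hΦ L hL
  rw [sum_sub_distrib, sum_sum_localBoard hrs hM.1 hM.2.1 𝒜
      (fun H hH => mem_traces_card hFe (mem_filter.1 hH).1) (fun H => (q.choose (r - H.card) : ℚ)),
    sum_sum_localBoard hrs hM.1 hM.2.1 𝒯
      (fun T hT => by
        have := mem_powersetCard.1 (mem_filter.1 hT).1
        exact ⟨this.1, this.2.le⟩) (fun _ => (1 : ℚ)), sum_const, nsmul_eq_mul, mul_one,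
    sub_nonpos] at hle
  have hle' : ∑ H ∈ 𝒜, q.choose (r - H.card) ≤ 𝒯.card := by exact_mod_cast hle
  have h1 := card_filter_not_subset_core_le (by omega) hFe
  have h2 : F.filter (· ⊆ core r s) = ((core r s).powersetCard r).filter (· ∈ F) := by
    ext E
    rw [mem_filter, mem_filter, mem_powersetCard]
    exact ⟨fun h => ⟨⟨h.2, (mem_allEdges.1 (hFe h.1)).2⟩, h.1⟩, fun h => ⟨h.2, h.1.1⟩⟩
  have h3 := card_filter_add_card_filter_not (s := F) (· ⊆ core r s)
  have h4 := card_filter_add_card_filter_not (s := (core r s).powersetCard r) (· ∈ F)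
  have hK : (core r s).card = r * s + r - 1 := by rw [core, Nat.card_Icc]; omega
  rw [card_powersetCard, hK, ← h𝒯] at h4
  rw [← h𝒜] at h1
  rw [h2] at h3
  unfold cliqueTerm
  omega

/-! ### Growth of the transition value -/

section Gap

open Filter Topology

lemma tendsto_choose_div_pow {α : ℕ} (hα : 1 ≤ α) (β k : ℕ) :
    Tendsto (fun t : ℕ => ((α * t + β).choose k : ℝ) / (t : ℝ) ^ k) atTop
      (𝓝 ((α : ℝ) ^ k / k.factorial)) := by
  have hlin : Tendsto (fun t : ℕ => α * t + β) atTop atTop :=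
    tendsto_atTop_mono (fun t => (Nat.le_mul_of_pos_left t hα).trans (Nat.le_add_right _ _))
      tendsto_id
  have hp : Tendsto (fun t : ℕ => (t : ℝ)⁻¹ * (α * t + β : ℕ)) atTop (𝓝 α) := by
    have h : Tendsto (fun t : ℕ => (α : ℝ) + β * (t : ℝ)⁻¹) atTop (𝓝 (α + β * 0)) :=
      (tendsto_inv_atTop_nhds_zero_nat.const_mul _).const_add _
    rw [mul_zero, add_zero] at h
    refine h.congr' ?_
    filter_upwards [eventually_gt_atTop 0] with t ht
    have : (t : ℝ) ≠ 0 := by positivity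
    push_cast
    field_simp
  have h1 := ((isEquivalent_choose k).comp_tendsto hlin).mul
    (Asymptotics.IsEquivalent.refl (u := fun t : ℕ => ((t : ℝ)⁻¹) ^ k))
  have h2 : Tendsto (fun t : ℕ => ((t : ℝ)⁻¹ * (α * t + β : ℕ)) ^ k / k.factorial) atTop
      (𝓝 ((α : ℝ) ^ k / k.factorial)) := (hp.pow k).div_const _
  refine Tendsto.congr (fun t => ?_) (h1.symm.tendsto_nhds (h2.congr fun t => ?_))
  · simp [div_eq_mul_inv]
  · simp only [Function.comp_apply, Pi.mul_apply]
    rw [mul_pow]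
    ring

/-- Binomial coefficients of equal lower index along arithmetic progressions are eventually compared
by their leading coefficients. -/
lemma eventually_mul_choose_le {a b α γ k : ℕ} (hα : 1 ≤ α) (hγ : 1 ≤ γ)
    (h : a * α ^ k < b * γ ^ k) (β δ : ℕ) :
    ∀ᶠ t : ℕ in atTop, a * (α * t + β).choose k ≤ b * (γ * t + δ).choose k := by
  have h1 := (tendsto_choose_div_pow hα β k).const_mul (a : ℝ)
  have h2 := (tendsto_choose_div_pow hγ δ k).const_mul (b : ℝ)
  have hlt : (a : ℝ) * ((α : ℝ) ^ k / k.factorial) < b * ((γ : ℝ) ^ k / k.factorial) := by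
    rw [← mul_div_assoc, ← mul_div_assoc]
    have : (a : ℝ) * (α : ℝ) ^ k < b * (γ : ℝ) ^ k := by exact_mod_cast h
    exact div_lt_div_of_pos_right this (by positivity)
  filter_upwards [h1.eventually_lt h2 hlt, eventually_gt_atTop 0] with t ht ht0
  have hpos : (0 : ℝ) < (t : ℝ) ^ k := by positivity
  rw [← mul_div_assoc, ← mul_div_assoc, div_lt_div_iff_of_pos_right hpos] at ht
  exact_mod_cast ht.le

lemma eventually_choose_lt_choose_succ {α γ : ℕ} (hα : 1 ≤ α) (hγ : 1 ≤ γ) (k β δ : ℕ) :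
    ∀ᶠ t : ℕ in atTop, (α * t + β).choose k < (γ * t + δ).choose (k + 1) := by
  have h1 := (tendsto_choose_div_pow hα β k).mul tendsto_inv_atTop_nhds_zero_nat
  have h2 := tendsto_choose_div_pow hγ δ (k + 1)
  have hlt : (α : ℝ) ^ k / k.factorial * 0 < (γ : ℝ) ^ (k + 1) / (k + 1).factorial := by
    rw [mul_zero]
    positivity
  filter_upwards [h1.eventually_lt h2 hlt, eventually_gt_atTop 0] with t ht ht0
  have hpos : (0 : ℝ) < (t : ℝ) ^ (k + 1) := by positivity
  rw [← div_eq_mul_inv, div_div, ← pow_succ, div_lt_div_iff_of_pos_right hpos] at ht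
  exact_mod_cast ht

lemma two_mul_pow_lt {r : ℕ} (hr : 2 ≤ r) : 2 * r ^ r < 1 * (r + 1) ^ r := by
  have key : ∀ m, r ^ m * (r + m) ≤ (r + 1) ^ m * r := by
    intro m
    induction m with
    | zero => simp
    | succ m ih =>
      calc r ^ (m + 1) * (r + (m + 1)) ≤ (r + 1) * (r ^ m * (r + m)) := by
            rw [pow_succ]
            nlinarith [Nat.zero_le (r ^ m * m)]
        _ ≤ (r + 1) * ((r + 1) ^ m * r) := Nat.mul_le_mul_left _ ih
        _ = (r + 1) ^ (m + 1) * r := by ring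
  obtain ⟨m, rfl⟩ := Nat.exists_eq_add_of_le' (show 1 ≤ r by omega)
  have h := key m
  have hpos : 0 < (m + 1) ^ m := by positivity
  refine Nat.lt_of_mul_lt_mul_right (a := m + 1) ?_
  calc 2 * (m + 1) ^ (m + 1) * (m + 1) = (m + 1) ^ m * (2 * (m + 1) * (m + 1)) := by ring
    _ < (m + 1) ^ m * ((m + 1 + m) * (m + 1 + 1)) := Nat.mul_lt_mul_of_pos_left (by nlinarith) hpos
    _ = (m + 1) ^ m * (m + 1 + m) * (m + 1 + 1) := by ring
    _ ≤ (m + 1 + 1) ^ m * (m + 1) * (m + 1 + 1) := Nat.mul_le_mul_right _ h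
    _ = 1 * (m + 1 + 1) ^ (m + 1) * (m + 1) := by ring

lemma two_mul_succ_pow_lt {r : ℕ} (hr : 3 ≤ r) :
    2 * (r + 1) ^ (r - 1) < (r + 1) * r ^ (r - 1) := by
  have key : ∀ m d, m + d = r + 1 → (r + 1) ^ m * d ≤ r ^ m * (r + 1) := by
    intro m
    induction m with
    | zero => intro d hd; simp; omega
    | succ m ih =>
      intro d hd
      have := ih (d + 1) (by omega)
      calc (r + 1) ^ (m + 1) * d = (r + 1) ^ m * ((r + 1) * d) := by ring
        _ ≤ (r + 1) ^ m * (r * (d + 1)) := Nat.mul_le_mul_left _ (by nlinarith)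
        _ = r * ((r + 1) ^ m * (d + 1)) := by ring
        _ ≤ r * (r ^ m * (r + 1)) := Nat.mul_le_mul_left _ this
        _ = r ^ (m + 1) * (r + 1) := by ring
  obtain ⟨m, rfl⟩ := Nat.exists_eq_add_of_le' (show 2 ≤ r by omega)
  have h := key m 3 (by omega)
  have hpos : 0 < (m + 2) ^ m := by positivity
  rw [show m + 2 - 1 = m + 1 by omega]
  refine Nat.lt_of_mul_lt_mul_right (a := 3) ?_
  calc 2 * (m + 2 + 1) ^ (m + 1) * 3 = 2 * (m + 3) * ((m + 2 + 1) ^ m * 3) := by ring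
    _ ≤ 2 * (m + 3) * ((m + 2) ^ m * (m + 2 + 1)) := Nat.mul_le_mul_left _ h
    _ = (m + 2) ^ m * (2 * (m + 3) * (m + 3)) := by ring
    _ < (m + 2) ^ m * ((m + 3) * (m + 2) * 3) := Nat.mul_lt_mul_of_pos_left (by nlinarith) hpos
    _ = (m + 2 + 1) * (m + 2) ^ (m + 1) * 3 := by ring

/-- Increments of binomial coefficients grow with the upper index. -/
lemma choose_add_choose_le {p q : ℕ} (hpq : p ≤ q) (k d : ℕ) :
    q.choose k + (p + d).choose k ≤ (q + d).choose k + p.choose k := by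
  cases k with
  | zero => simp
  | succ k =>
    induction d with
    | zero => simp
    | succ d ih =>
      rw [← add_assoc, ← add_assoc, Nat.choose_succ_succ', Nat.choose_succ_succ' (q + d)]
      have := Nat.choose_le_choose k (Nat.add_le_add_right hpq d)
      omega

lemma choose_add_mul_choose_le (m k j : ℕ) :
    m.choose (k + 1) + j * m.choose k ≤ (m + j).choose (k + 1) := by
  induction j with
  | zero => simp
  | succ j ih =>
    rw [← add_assoc, Nat.choose_succ_succ', add_mul, one_mul]
    have := Nat.choose_le_choose k (Nat.le_add_right m j)
    omega

lemma transition_le {r t n : ℕ} (h1 : r * (t + 1) ≤ n) (h2 : cliqueTerm r t ≤ coverTerm r n t) :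
    transition r t ≤ n :=
  Nat.sInf_le ⟨h1, h2⟩

/-- A criterion for the gap condition: it suffices to compare `t` with `t - 1` on the admissible
values of `n` up to some admissible `n₀`. -/
lemma isGapThreshold_of {r T : ℕ} (hr : 2 ≤ r)
    (h : ∀ t, T ≤ t → ∃ n₀, (r * (t + 2) ≤ n₀ ∧ cliqueTerm r (t + 1) ≤ coverTerm r n₀ (t + 1)) ∧
      ∀ n, r * (t + 2) ≤ n → cliqueTerm r (t + 1) ≤ coverTerm r n (t + 1) → n ≤ n₀ →
        n ≠ r * (t + 2) ∧ cliqueTerm r t ≤ coverTerm r (n - 2) t) :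
    IsGapThreshold r (T + 1) := by
  intro t ht
  obtain ⟨t, rfl⟩ := Nat.exists_eq_add_of_le' (show 1 ≤ t by omega)
  obtain ⟨n₀, hn₀, hmain⟩ := h t (by omega)
  obtain ⟨h1, h2⟩ : transition r (t + 1) ∈
      {n : ℕ | r * (t + 1 + 1) ≤ n ∧ cliqueTerm r (t + 1) ≤ coverTerm r n (t + 1)} :=
    Nat.sInf_mem ⟨n₀, hn₀⟩
  obtain ⟨h3, h4⟩ := hmain _ h1 h2 (transition_le hn₀.1 hn₀.2)
  have h5 : r * (t + 2) = r * (t + 1) + r := by ring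
  have h6 := transition_le (r := r) (t := t) (n := transition r (t + 1) - 2) (by
    have : r * (t + 1 + 1) = r * (t + 1) + r := by ring
    omega) h4
  rw [Nat.add_sub_cancel]
  have h7 : r * (t + 1 + 1) = r * (t + 2) := by ring
  constructor <;> omega

lemma two_mul_choose_two (m : ℕ) : 2 * (m + 1).choose 2 = (m + 1) * m := by
  rw [Nat.choose_two_right, Nat.add_sub_cancel]
  exact Nat.mul_div_cancel' (by rw [mul_comm]; exact (Nat.even_mul_succ_self m).two_dvd)

lemma cliqueTerm_le_coverTerm_two_iff {t n : ℕ} (hn : t + 1 ≤ n) (ht : 1 ≤ t) :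
    cliqueTerm 2 t ≤ coverTerm 2 n t ↔ 5 * t + 3 ≤ 2 * n := by
  obtain ⟨u, rfl⟩ := Nat.exists_eq_add_of_le' hn
  rw [le_coverTerm_iff, cliqueTerm, show 2 * t + 2 - 1 = 2 * t + 1 by omega,
    show u + (t + 1) - t = u + 1 by omega, ← add_assoc]
  have h1 := two_mul_choose_two (2 * t)
  have h2 := two_mul_choose_two u
  have h3 := two_mul_choose_two (u + t)
  have h4 : (2 * t + 1).choose 2 + (u + 1).choose 2 ≤ (u + t + 1).choose 2 ↔
      (2 * t + 1) * (2 * t) + (u + 1) * u ≤ (u + t + 1) * (u + t) := by omega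
  rw [h4]
  constructor
  · intro h
    have : t * (3 * t + 1) ≤ t * (2 * u) := by nlinarith
    have := Nat.le_of_mul_le_mul_left this ht
    omega
  · intro h
    have : t * (3 * t + 1) ≤ t * (2 * u) := Nat.mul_le_mul_left _ (by omega)
    nlinarith

lemma isGapThreshold_two : IsGapThreshold 2 2 := by
  refine isGapThreshold_of (T := 1) le_rfl fun t ht => ⟨3 * t + 6, ⟨by omega, ?_⟩, ?_⟩
  · rw [cliqueTerm_le_coverTerm_two_iff (by omega) (by omega)]
    omega
  · intro n h1 h2 _
    rw [cliqueTerm_le_coverTerm_two_iff (by omega) (by omega)] at h2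
    refine ⟨by omega, ?_⟩
    rw [cliqueTerm_le_coverTerm_two_iff (by omega) (by omega)]
    omega

/-- The gap condition holds from some point on. For `r ≥ 3` the transition value is eventually at
most `(r + 1) t`, and in that range passing from `(n - 2, t - 1)` to `(n, t)` raises the clique term
by at least as much as the cover term. -/
lemma exists_isGapThreshold {r : ℕ} (hr : 2 ≤ r) : ∃ T, IsGapThreshold r T := by
  rcases hr.eq_or_lt with rfl | hr3
  · exact ⟨2, isGapThreshold_two⟩
  have e1 := eventually_mul_choose_le (k := r - 1) (by omega) (by omega)
    (two_mul_succ_pow_lt (r := r) hr3) r (r - 1)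
  have e2 := eventually_mul_choose_le (k := r) (by omega) (by omega)
    (two_mul_pow_lt hr) (2 * r - 1) (r + 1)
  have e3 := eventually_choose_lt_choose_succ (α := r) (γ := r - 1) (by omega) (by omega)
    (r - 1) (2 * r - 1) (2 * r - 1)
  obtain ⟨T, hT⟩ := eventually_atTop.1 (e1.and (e2.and (e3.and (eventually_ge_atTop r))))
  refine ⟨T + 1, isGapThreshold_of hr fun t ht => ?_⟩
  obtain ⟨h1, h2, h3, h4⟩ := hT t ht
  obtain ⟨k, rfl⟩ := Nat.exists_eq_add_of_le' (show 1 ≤ r by omega)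
  rw [Nat.add_sub_cancel] at h1 h3
  have hc : cliqueTerm (k + 1) (t + 1) = ((k + 1) * t + (2 * (k + 1) - 1)).choose (k + 1) := by
    unfold cliqueTerm
    congr 1
    rw [mul_add]
    omega
  have hc0 : cliqueTerm (k + 1) t = ((k + 1) * t + k).choose (k + 1) := rfl
  have hexp : (k + 1) * (t + 2) = (k + 1) * t + 2 * (k + 1) := by ring
  have hexp' : (k + 1 + 1) * t = (k + 1) * t + t := by ring
  obtain ⟨x, hx⟩ : ∃ x, x = (k + 1) * t := ⟨_, rfl⟩
  have hxt : t ≤ x := hx ▸ Nat.le_mul_of_pos_left t (by omega)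
  refine ⟨(k + 1 + 1) * t + (k + 1 + 1), ⟨by omega, ?_⟩, fun n hn1 hn2 hn3 => ⟨?_, ?_⟩⟩
  · rw [le_coverTerm_iff, hc]
    have := Nat.choose_le_choose (k + 1) (show (k + 1 + 1) * t + (k + 1 + 1) - (t + 1)
      ≤ (k + 1) * t + (2 * (k + 1) - 1) by omega)
    omega
  · rintro rfl
    rw [le_coverTerm_iff, hc, hexp,
      show (k + 1) * t + 2 * (k + 1) = (k + 1) * t + (2 * (k + 1) - 1) + 1 by omega,
      Nat.choose_succ_succ'] at hn2
    have := Nat.choose_le_choose (k + 1) (show k * t + (2 * (k + 1) - 1)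
      ≤ (k + 1) * t + (2 * (k + 1) - 1) + 1 - (t + 1) by rw [add_mul]; omega)
    omega
  · obtain ⟨m, rfl⟩ := Nat.exists_eq_add_of_le' (show 2 ≤ n by omega)
    obtain ⟨v, rfl⟩ := Nat.exists_eq_add_of_le' (show t ≤ m by omega)
    obtain ⟨d, hd⟩ := Nat.exists_eq_add_of_le hn3
    rw [le_coverTerm_iff, hc, show v + t + 2 - (t + 1) = v + 1 by omega, Nat.choose_succ_succ',
      show v + t + 2 = v + t + 1 + 1 by omega, Nat.choose_succ_succ' (v + t + 1),
      Nat.choose_succ_succ' (v + t)] at hn2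
    rw [le_coverTerm_iff, Nat.add_sub_cancel, Nat.add_sub_cancel, hc0]
    have i1 := choose_add_mul_choose_le ((k + 1) * t + k) k (k + 1)
    rw [show (k + 1) * t + k + (k + 1) = (k + 1) * t + (2 * (k + 1) - 1) by omega] at i1
    have i2 := choose_add_choose_le (show v ≤ v + t + 1 by omega) k d
    rw [show v + d = (k + 1) * t + k by omega,
      show v + t + 1 + d = (k + 1 + 1) * t + (k + 1) by omega] at i2
    have i3 := Nat.choose_le_choose k (show v + t ≤ (k + 1 + 1) * t + (k + 1) by omega)
    rw [add_mul (k + 1) 1 (Nat.choose _ _), one_mul] at h1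
    omega

end Gap

/-! ### Passing from the transition value to all `n` -/

lemma IsGapThreshold.transition_spec {r T t : ℕ} (hT : IsGapThreshold r T) (ht : T ≤ t) :
    r * (t + 1) ≤ transition r t ∧ cliqueTerm r t ≤ coverTerm r (transition r t) t := by
  refine Nat.sInf_mem (s := {n : ℕ | r * (t + 1) ≤ n ∧ cliqueTerm r t ≤ coverTerm r n t}) ?_
  refine Nat.nonempty_of_pos_sInf ?_
  have := (hT t ht).2
  unfold transition at this
  omega

/-- Above the transition value the cover bound for stable families propagates upwards, by deleting
the last vertex and applying the bound for the link. -/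
lemma card_le_coverTerm_of_restrict {r t N n T : ℕ} (hr : 2 ≤ r) (hlink : LinkBoundInput r T)
    (ht : T ≤ t) (hN : transition r t ≤ N) (hNr : r * (t + 1) ≤ N) (hn : N ≤ n)
    {F : Finset (Finset ℕ)} (hF : IsStable r n F) (hs : matchingNumber F ≤ t)
    (hbase : (F.filter (· ⊆ Icc 1 N)).card ≤ coverTerm r N t) :
    F.card ≤ coverTerm r n t := by
  classical
  induction n, hn using Nat.le_induction generalizing F with
  | base =>
    rwa [filter_true_of_mem fun E hE => (mem_allEdges.1 (hF.1 hE)).1] at hbase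
  | succ n hn ih =>
    have htn : t ≤ n := by
      have : t + 1 ≤ r * (t + 1) := Nat.le_mul_of_pos_left _ (by omega)
      omega
    have hdel : F.filter (n + 1 ∉ ·) = F.filter (· ⊆ Icc 1 n) := by
      refine filter_congr fun E hE => ?_
      have hE1 := (mem_allEdges.1 (hF.1 hE)).1
      constructor
      · intro h x hx
        have := mem_Icc.1 (hE1 hx)
        have : x ≠ n + 1 := fun hxn => h (hxn ▸ hx)
        exact mem_Icc.2 (by omega)
      · intro h hn
        have := mem_Icc.1 (h hn)
        omega
    have hlinksub : link (n + 1) F ⊆ allEdges (r - 1) n := by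
      intro H hH
      obtain ⟨h1, h2⟩ := mem_link.1 hH
      obtain ⟨h3, h4⟩ := mem_allEdges.1 (hF.1 h2)
      rw [card_insert_of_notMem h1] at h4
      refine mem_allEdges.2 ⟨fun x hx => ?_, by omega⟩
      have := mem_Icc.1 (h3 (mem_insert_of_mem hx))
      have : x ≠ n + 1 := fun hxn => h1 (hxn ▸ hx)
      exact mem_Icc.2 (by omega)
    rw [card_eq_card_filter_add_card_link (n + 1), hdel, coverTerm_succ_left (by omega) htn]
    refine Nat.add_le_add (ih (hF.restrict (by omega))
      ((matchingNumber_mono (filter_subset _ _)).trans hs) ?_) ?_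
    · refine (card_le_card fun E hE => ?_).trans hbase
      rw [mem_filter, mem_filter] at hE
      exact mem_filter.2 ⟨hE.1.1, hE.2⟩
    · refine hlink t ht n (by omega) _ hlinksub
        (matchingNumber_link_le hr hF.1 hF.shiftClosed hs ?_)
      rw [Nat.card_Icc]
      omega

section Reduction

variable {r : ℕ} {S : SelectionRule r} {sGap sLink sBoard : ℕ}

/-- At the transition value and just below it, property-ONE families obey the clique bound. -/
lemma card_le_cliqueTerm_of_hasOne (hr : 2 ≤ r) (hgap : IsGapThreshold r sGap)
    (hboard : FiniteBoardInput S sBoard) {t n : ℕ}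
    (ht : max r (max sGap (max sLink sBoard)) ≤ t)
    (hn : n = transition r t - 1 ∨ n = transition r t) {F : Finset (Finset ℕ)}
    (hF : IsStableMaximalOne r n t F) : F.card ≤ cliqueTerm r t := by
  simp only [max_le_iff] at ht
  have h1 := (hgap t ht.2.1).2
  have hn' : r * t + r - 1 + (n - (r * t + r - 1)) = n := by
    rw [mul_add] at h1
    omega
  refine card_le_cliqueTerm (q := n - (r * t + r - 1)) hr ht.1 S (by rwa [hn']) fun L hL => ?_
  exact hboard t ht.2.2.2 n hn L hL

/-- The cover bound descends along `(n, t) ↦ (n - 1, t - 1)`. A family without property ONE is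
handled by deleting vertex `1`. A family with property ONE is restricted to `[n_r(t)]` and enlarged
to a maximal one, which still has property ONE, so that the clique bound applies there. -/
lemma maxEdges_le_coverTerm_succ (hr : 2 ≤ r) (hgap : IsGapThreshold r sGap)
    (hlink : LinkBoundInput r sLink) (hboard : FiniteBoardInput S sBoard) {t n : ℕ}
    (ht : max r (max sGap (max sLink sBoard)) ≤ t + 1) (hn : transition r (t + 1) ≤ n + 1)
    (hprev : maxEdges r n t ≤ coverTerm r n t) :
    maxEdges r (n + 1) (t + 1) ≤ coverTerm r (n + 1) (t + 1) := by
  classical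
  have ht' := ht
  simp only [max_le_iff] at ht'
  obtain ⟨hN1, hN2⟩ := hgap.transition_spec ht'.2.1
  set N := transition r (t + 1) with hN
  obtain ⟨G, hG, hGs, -, hGc⟩ := exists_stable_maximal_card_eq (r := r) (n := n + 1)
    (s := t + 1) (by omega) (by omega)
  rw [← hGc]
  by_cases hone : HasOne G
  · have hres := hG.restrict hn
    obtain ⟨G', hsub, hst, hν, hmax, -⟩ := exists_stable_maximal (by omega) hN1 hres
      ((matchingNumber_mono (filter_subset _ _)).trans hGs.le)
    have hone' : HasOne G' := hG.hasOne_of_restrict_subset (by omega) hGs hone (by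
      rw [mul_add] at hN1
      omega) hsub hν
    have hle := card_le_cliqueTerm_of_hasOne hr hgap hboard ht (Or.inr hN)
      ⟨hst, hν, hone', hmax⟩
    exact card_le_coverTerm_of_restrict hr hlink ht'.2.2.1 le_rfl hN1 hn hG hGs.le
      ((card_le_card hsub).trans (hle.trans hN2))
  · have h := card_le_of_not_hasOne (by omega) hG.1 hGs hone
    rw [coverTerm_succ_succ (by omega)]
    omega

/-- The cover bound holds at and above the transition value. The descent stops at half the matching
number, where there are enough vertices for the unconditional cover bound. -/
lemma maxEdges_le_coverTerm_of_transition_le (hr : 2 ≤ r) (hgap : IsGapThreshold r sGap)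
    (hlink : LinkBoundInput r sLink) (hboard : FiniteBoardInput S sBoard) {t₀ i n : ℕ}
    (ht : max r (max sGap (max sLink sBoard)) ≤ t₀ + 1) (hi : 1 ≤ i → transition r (t₀ + i) ≤ n)
    (hn : (2 * t₀ + 1) * r + i ≤ n + t₀) :
    maxEdges r n (t₀ + i) ≤ coverTerm r n (t₀ + i) := by
  induction i generalizing n with
  | zero =>
    refine maxEdges_le_coverTerm (by omega) (by omega) ?_
    have h1 : (2 * t₀ + 1) * r = r * (t₀ + 1) + t₀ * r := by ring
    have h2 : t₀ ≤ t₀ * r := Nat.le_mul_of_pos_right _ (by omega)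
    rw [Nat.add_zero]
    omega
  | succ i ih =>
    have h1 : t₀ + 1 ≤ (2 * t₀ + 1) * r := by nlinarith
    obtain ⟨n, rfl⟩ := Nat.exists_eq_add_of_le' (show 1 ≤ n by omega)
    have htr := hi (by omega)
    refine maxEdges_le_coverTerm_succ (t := t₀ + i) hr hgap hlink hboard (by omega) htr
      (ih (fun _ => ?_) (by omega))
    simp only [max_le_iff] at ht
    have := (hgap (t₀ + i + 1) (by omega)).1
    rw [Nat.add_sub_cancel] at this
    rw [← add_assoc] at htr
    omega

/-- The matching bound for all `s` beyond twice the common threshold. -/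
lemma maxEdges_eq_extremalBound (hr : 2 ≤ r) (hgap : IsGapThreshold r sGap)
    (hlink : LinkBoundInput r sLink) (hboard : FiniteBoardInput S sBoard) {s n : ℕ}
    (hs : 2 * max r (max sGap (max sLink sBoard)) - 1 ≤ s) (hn : r * (s + 1) ≤ n) :
    maxEdges r n s = extremalBound r n s := by
  obtain ⟨m, hm⟩ : ∃ m, max r (max sGap (max sLink sBoard)) = m := ⟨_, rfl⟩
  have hmr : r ≤ m := hm ▸ le_max_left _ _
  have hmg : sGap ≤ m := hm ▸ (le_max_left _ _).trans (le_max_right _ _)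
  rw [hm] at hs
  have hsn : s ≤ n := by
    have : s + 1 ≤ r * (s + 1) := Nat.le_mul_of_pos_left _ (by omega)
    omega
  have hrs : r * (s + 1) = r * s + r := by ring
  refine le_antisymm ?_ (max_le (cliqueTerm_le_maxEdges (by omega) (by omega))
    (coverTerm_le_maxEdges hsn))
  -- the descent from `s` to `t₀ = ⌊s / 2⌋`
  obtain ⟨t₀, i, hsi, ht₀, hi⟩ : ∃ t₀ i, s = t₀ + (i + 1) ∧ m ≤ t₀ + 1 ∧ t₀ ≤ i + 1 ∧ i ≤ t₀ :=
    ⟨s / 2, s - s / 2 - 1, by omega, by omega, by omega, by omega⟩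
  have hsr : (2 * t₀ + 1) * r + (i + 1) ≤ r * (s + 1) + t₀ := by
    have h1 : r * (s + 1) = (2 * t₀ + 1) * r + r * (i + 1 - t₀) := by
      obtain ⟨d, hd⟩ := Nat.exists_eq_add_of_le hi.1
      rw [hsi, hd, Nat.add_sub_cancel_left]
      ring
    have h2 : i + 1 - t₀ ≤ r * (i + 1 - t₀) := Nat.le_mul_of_pos_left _ (by omega)
    omega
  have htrans := (hgap s (by omega))
  by_cases hcase : transition r s ≤ n
  · refine le_trans ?_ (le_max_right _ _)
    rw [hsi] at hcase ⊢
    exact maxEdges_le_coverTerm_of_transition_le hr hgap hlink hboard (hm ▸ ht₀)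
      (fun _ => hcase) (by omega)
  · refine le_trans ?_ (le_max_left _ _)
    obtain ⟨N, hN⟩ : ∃ N, transition r s = N + 1 := ⟨transition r s - 1, by omega⟩
    have hlt : coverTerm r N s < cliqueTerm r s := by
      by_contra hcon
      have : transition r s ≤ N := transition_le (by omega) (not_lt.1 hcon)
      omega
    refine (maxEdges_mono (show n ≤ N by omega)).trans ?_
    obtain ⟨G, hG, hGs, hGm, hGc⟩ := exists_stable_maximal_card_eq (r := r) (n := N) (s := s)
      (by omega) (by omega)
    rw [← hGc]
    by_cases hone : HasOne G
    · exact card_le_cliqueTerm_of_hasOne hr hgap hboard (by rw [hm]; omega) (Or.inl (by omega))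
        ⟨hG, hGs, hone, hGm⟩
    · obtain ⟨N, rfl⟩ := Nat.exists_eq_add_of_le' (show 1 ≤ N by omega)
      have hs' : s = t₀ + i + 1 := by omega
      have h := card_le_of_not_hasOne (by omega) hG.1 (hGs.trans hs') hone
      have hprev : maxEdges r N (t₀ + i) ≤ coverTerm r N (t₀ + i) := by
        refine maxEdges_le_coverTerm_of_transition_le hr hgap hlink hboard (hm ▸ ht₀)
          (fun _ => ?_) (by omega)
        have := htrans.1
        rw [show s - 1 = t₀ + i by omega] at this
        omega
      rw [hs', coverTerm_succ_succ (by omega)] at hlt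
      rw [hs']
      omega

end Reduction

end EMC

theorem mainTheorem2 (r : ℕ) (hr : 2 ≤ r) :
    (∃ sGap : ℕ, EMC.IsGapThreshold r sGap) ∧
    ∀ (S : EMC.SelectionRule r) (sGap sLink sBoard : ℕ),
      EMC.IsGapThreshold r sGap → EMC.LinkBoundInput r sLink → EMC.FiniteBoardInput S sBoard →
      ∀ s : ℕ, 2 * max r (max sGap (max sLink sBoard)) - 1 ≤ s →
      ∀ n : ℕ, r * (s + 1) ≤ n →
        EMC.maxEdges r n s = EMC.extremalBound r n s :=
  ⟨EMC.exists_isGapThreshold hr, fun _ _ _ _ hgap hlink hboard _ hs _ hn =>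
    EMC.maxEdges_eq_extremalBound hr hgap hlink hboard hs hn⟩
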